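/- For an integer $p\ge 1$ and a kernel $K:\mathbb{R}\to\mathbb{R}$ put $r_p(u)=(1,u,\dots,u^p)'$, $e_1=(0,1,0,\dots,0)'\in\mathbb{R}^{p+1}$, $$A_{p,K}=\int_{-\infty}^0 r_p(u)r_p(u)'K(u)\,du,\qquad c_{p,K}=\int_{-\infty}^0 r_p(u)u^{p+1}K(u)\,du,$$ $$B_{p,K}=\int_{-\infty}^0\int_{-\infty}^0\min\{u,v\}\,r_p(u)r_p(v)'K(u)K(v)\,du\,dv,$$ and $$\mathcal{B}_{p,K}=e_1'A_{p,K}^{-1}c_{p,K},\qquad \mathcal{V}_{p,K}=e_1'A_{p,K}^{-1}B_{p,K}A_{p,K}^{-1}e_1,\qquad Q_{p,K}=(\mathcal{B}_{p,K}^2)^{1/(2p+1)}\,\mathcal{V}_{p,K}^{2p/(2p+1)}.$$ The local polynomial density estimator of order $p$ with kernel $K$, bandwidth $h>0$ and sample size $n\ge1$, at a right boundary point $x_R$ of the support where the density takes the value $f(x_R)>0$ and has $p$-th derivative $f^{(p)}(x_R)\neq 0$, has asymptotic variance $\frac{f(x_R)}{nh}\mathcal{V}_{p,K}$ and asymptotic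 mean squared error $$\mathrm{MSE}_{p,K}(h)=\Bigl(h^p\frac{f^{(p)}(x_R)}{(p+1)!}\mathcal{B}_{p,K}\Bigr)^2+\frac{f(x_R)}{nh}\mathcal{V}_{p,K}.$$ The MSE-optimal bandwidth is $$h^{\mathrm{MSE}}_{p,K}=\Bigl(\frac{\mathcal{V}_{p,K}}{C\,\mathcal{B}_{p,K}^2}\Bigr)^{1/(2p+1)}n^{-1/(2p+1)},\qquad C=\frac{2p}{f(x_R)}\Bigl(\frac{f^{(p)}(x_R)}{(p+1)!}\Bigr)^2 .$$ Let $p\in\{1,2,3\}$, let $S(u)=\exp(-|u|)/2$ be the spline-type kernel, and let $K$ be any of the following four kernels: triangular $(1-|u|)\mathbf 1\{u^2<1\}$, uniform $\frac12\mathbf 1\{u^2<1\}$, Epanechnikov $\frac34(1-u^2)\mathbf 1\{u^2<1\}$, Gaussian $\exp(-u^2/2)/\sqrt{2\pi}$. Then 1. $\mathcal{V}_{p,S}<\mathcal{V}_{p,K}$; 2. $Q_{p,S}<Q_{p,K}$; 3. for all $f(x_R)>0$, $h>0$ and $n\ge 1$, the asymptotic variance $\frac{f(x_R)}{nh}\mathcal{V}_{p,S}$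 with the spline-type kernel is smaller than $\frac{f(x_R)}{nh}\mathcal{V}_{p,K}$; 4. for all $f(x_R)>0$, $f^{(p)}(x_R)\ne0$ and $n\ge1$, $\mathrm{MSE}_{p,S}(h^{\mathrm{MSE}}_{p,S})<\mathrm{MSE}_{p,K}(h^{\mathrm{MSE}}_{p,K})$. That is, among the five kernels the asymptotic variance and the asymptotic mean squared error at the MSE-optimal bandwidth are smallest, strictly, for the spline-type kernel. -/

import Mathlib

open scoped Matrix

namespace LPD

noncomputable section

/-- The triangular kernel `(1 - |u|) 1{u² < 1}`. -/
def triangular (u : ℝ) : ℝ := Set.indicator {x : ℝ | x ^ 2 < 1} (fun x => 1 - |x|) u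

/-- The uniform kernel `(1/2) 1{u² < 1}`. -/
def uniform (u : ℝ) : ℝ := Set.indicator {x : ℝ | x ^ 2 < 1} (fun _ => 1 / 2) u

/-- The Epanechnikov kernel `(3/4) (1 - u²) 1{u² < 1}`. -/
def epanechnikov (u : ℝ) : ℝ :=
  Set.indicator {x : ℝ | x ^ 2 < 1} (fun x => 3 / 4 * (1 - x ^ 2)) u

/-- The Gaussian kernel `exp (-u²/2) / √(2π)`. -/
def gaussian (u : ℝ) : ℝ := Real.exp (-u ^ 2 / 2) / Real.sqrt (2 * Real.pi)

/-- The spline-type kernel `exp (-|u|) / 2`. -/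
def spline (u : ℝ) : ℝ := Real.exp (-|u|) / 2

/-- The class of the five kernels that are compared. -/
def kernelClass : Set (ℝ → ℝ) := {triangular, uniform, epanechnikov, gaussian, spline}

/-- `r_p(u) = (1, u, …, u^p)'`. -/
def monomials (p : ℕ) (u : ℝ) : Fin (p + 1) → ℝ := fun i => u ^ (i : ℕ)

/-- `A_{p,K} = ∫_{-∞}^0 r_p(u) r_p(u)' K(u) du`, entrywise. -/
def matA (p : ℕ) (K : ℝ → ℝ) : Matrix (Fin (p + 1)) (Fin (p + 1)) ℝ :=
  Matrix.of fun i j => ∫ u in Set.Iic (0 : ℝ), monomials p u i * monomials p u j * K u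

/-- `B_{p,K} = ∫_{-∞}^0 ∫_{-∞}^0 min{u,v} r_p(u) r_p(v)' K(u) K(v) du dv`, entrywise. -/
def matB (p : ℕ) (K : ℝ → ℝ) : Matrix (Fin (p + 1)) (Fin (p + 1)) ℝ :=
  Matrix.of fun i j => ∫ v in Set.Iic (0 : ℝ), ∫ u in Set.Iic (0 : ℝ),
    min u v * monomials p u i * monomials p v j * K u * K v

/-- `c_{p,K} = ∫_{-∞}^0 r_p(u) u^{p+1} K(u) du`, entrywise. -/
def vecC (p : ℕ) (K : ℝ → ℝ) : Fin (p + 1) → ℝ :=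
  fun i => ∫ u in Set.Iic (0 : ℝ), monomials p u i * u ^ (p + 1) * K u

/-- `e₁ = (0, 1, 0, …, 0)'`: coordinates are numbered from `0` (used for `p ≥ 1`). -/
def e₁ (p : ℕ) : Fin (p + 1) → ℝ := Pi.single 1 1

/-- The bias constant `e₁' A⁻¹ c`. -/
def biasConst (p : ℕ) (K : ℝ → ℝ) : ℝ := e₁ p ⬝ᵥ ((matA p K)⁻¹ *ᵥ vecC p K)

/-- The variance constant `V_{p,K} = e₁' A⁻¹ B A⁻¹ e₁`. -/
def varConst (p : ℕ) (K : ℝ → ℝ) : ℝ :=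
  e₁ p ⬝ᵥ (((matA p K)⁻¹ * matB p K * (matA p K)⁻¹) *ᵥ e₁ p)

/-- The MSE-efficiency constant `Q_{p,K} = (bias²)^{1/(2p+1)} V^{2p/(2p+1)}`. -/
def mseConst (p : ℕ) (K : ℝ → ℝ) : ℝ :=
  (biasConst p K ^ 2) ^ (1 / (2 * p + 1) : ℝ) * varConst p K ^ (2 * p / (2 * p + 1) : ℝ)

/-- The asymptotic bias of the estimator, `h^p f^{(p)}(x_R) / (p+1)! · (e₁' A⁻¹ c)`;
`fp` is the value `f^{(p)}(x_R)`. -/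
def asymBias (p : ℕ) (K : ℝ → ℝ) (fp h : ℝ) : ℝ :=
  h ^ p * (fp / (p + 1).factorial) * biasConst p K

/-- The asymptotic variance of the estimator, `f(x_R) / (n h) · V_{p,K}`;
`f₀` is the value `f(x_R)`. -/
def asymVar (p : ℕ) (K : ℝ → ℝ) (f₀ : ℝ) (n : ℕ) (h : ℝ) : ℝ :=
  f₀ / (n * h) * varConst p K

/-- The asymptotic mean squared error of the estimator. -/
def asymMSE (p : ℕ) (K : ℝ → ℝ) (f₀ fp : ℝ) (n : ℕ) (h : ℝ) : ℝ :=
  asymBias p K fp h ^ 2 + asymVar p K f₀ n h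

/-- The kernel-free constant `C` in the MSE-optimal bandwidth. -/
def bandwidthConst (p : ℕ) (f₀ fp : ℝ) : ℝ :=
  2 * p * (fp / (p + 1).factorial) ^ 2 / f₀

/-- The MSE-optimal bandwidth `(V / (C · bias²))^{1/(2p+1)} n^{-1/(2p+1)}`, the minimizer over
`h > 0` of the asymptotic mean squared error. -/
def mseBandwidth (p : ℕ) (K : ℝ → ℝ) (f₀ fp : ℝ) (n : ℕ) : ℝ :=
  (varConst p K / (bandwidthConst p f₀ fp * biasConst p K ^ 2)) ^ (1 / (2 * p + 1) : ℝ) *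
    (n : ℝ) ^ (-1 / (2 * p + 1) : ℝ)

end

end LPD

/-! The theorem is a finite comparison: three orders `p` and four competing kernels. At the
bandwidth `h` with `h^(2p+1) = V / (C b² n)`, the squared bias is `1/(2p)` times the variance, and
`V / h = (C n)^(1/(2p+1)) Q`. The minimal MSE is therefore a positive kernel-free factor times `Q`
(`asymMSE_mseBandwidth`). Since `Q` is the `(2p+1)`-th root of `b² V^(2p)`, all four claims follow
from `V_S < V_K` and `b_S² V_S^(2p) < b_K² V_K^(2p)` (`minimality_of_constants`).

The constants come from the vector `a` with `A a = e₁`: by symmetry of `A`, the bias is `a · c` and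
the variance is `a' B a`, so no inverse is computed. For `B`, write `min u v = u - (u - v)⁺` and
integrate by parts: the inner integral is expressed through a second antiderivative of `u^i K`, and
every entry becomes a combination of one-dimensional integrals (`integral_min_mul`, `matB_apply`).

For the compactly supported kernels these integrals are polynomial, for the spline-type kernel they
are factorials over powers of two, and in both cases the constants are exact rationals. For the
Gaussian the antiderivatives involve the mass of `[v, 0]`. Recursions reduce everything to rational
functions of `1/√(2π)` and `1/(4√π)`, and digits of `π` give lower bounds, which suffice for a
competitor. -/

namespace LPD

/-! ### Bias and variance constants through the solution of `A a = e₁`. -/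

section Algebra

theorem matA_isSymm (p : ℕ) (K : ℝ → ℝ) : (matA p K)ᵀ = matA p K := by
  ext i j
  simp only [matA, Matrix.transpose_apply, Matrix.of_apply]
  congr 1
  ext u
  ring

theorem inv_mulVec_e₁ {p : ℕ} {K : ℝ → ℝ} {a : Fin (p + 1) → ℝ}
    (hdet : (matA p K).det ≠ 0) (ha : matA p K *ᵥ a = e₁ p) :
    (matA p K)⁻¹ *ᵥ e₁ p = a := by
  rw [← ha, Matrix.mulVec_mulVec, Matrix.nonsing_inv_mul _ hdet.isUnit, Matrix.one_mulVec]

/-- Symmetry of `A` passes to its inverse, so one vector `a` serves on both sides of `B`. -/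
theorem e₁_vecMul_inv {p : ℕ} {K : ℝ → ℝ} {a : Fin (p + 1) → ℝ}
    (hdet : (matA p K).det ≠ 0) (ha : matA p K *ᵥ a = e₁ p) :
    e₁ p ᵥ* (matA p K)⁻¹ = a := by
  rw [← Matrix.mulVec_transpose, Matrix.transpose_nonsing_inv, matA_isSymm,
    inv_mulVec_e₁ hdet ha]

theorem biasConst_eq {p : ℕ} {K : ℝ → ℝ} {a : Fin (p + 1) → ℝ}
    (hdet : (matA p K).det ≠ 0) (ha : matA p K *ᵥ a = e₁ p) :
    biasConst p K = a ⬝ᵥ vecC p K := by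
  rw [biasConst, Matrix.dotProduct_mulVec, e₁_vecMul_inv hdet ha]

theorem varConst_eq {p : ℕ} {K : ℝ → ℝ} {a : Fin (p + 1) → ℝ}
    (hdet : (matA p K).det ≠ 0) (ha : matA p K *ᵥ a = e₁ p) :
    varConst p K = a ⬝ᵥ (matB p K *ᵥ a) := by
  rw [varConst, ← Matrix.mulVec_mulVec, ← Matrix.mulVec_mulVec, inv_mulVec_e₁ hdet ha,
    Matrix.dotProduct_mulVec, e₁_vecMul_inv hdet ha]

end Algebra

/-! ### Reduction of all four claims to inequalities between constants. -/

section Comparison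

/-- The root `x ↦ x^(1/(2p+1))` is strictly increasing on nonnegative reals. Removing it leaves
natural-number powers only, which can be compared numerically. -/
theorem mseConst_lt_mseConst {p : ℕ} {K L : ℝ → ℝ} (hL : 0 < varConst p L)
    (hK : 0 < varConst p K)
    (h : biasConst p L ^ 2 * varConst p L ^ (2 * p) <
      biasConst p K ^ 2 * varConst p K ^ (2 * p)) :
    mseConst p L < mseConst p K := by
  have key : ∀ M : ℝ → ℝ, 0 < varConst p M →
      mseConst p M = (biasConst p M ^ 2 * varConst p M ^ (2 * p)) ^ (1 / (2 * p + 1) : ℝ) := by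
    intro M hM
    rw [mseConst, Real.mul_rpow (sq_nonneg _) (by positivity), ← Real.rpow_natCast _ (2 * p),
      ← Real.rpow_mul hM.le]
    congr 2
    push_cast
    ring
  rw [key L hL, key K hK]
  exact Real.rpow_lt_rpow (by positivity) h (by positivity)

/-- Only the equation for `h^(2p+1)` matters: it makes the squared bias `1/(2p)` of the variance,
and the kernel then enters through `Q` alone. -/
theorem asymMSE_mseBandwidth {p : ℕ} (hp : 1 ≤ p) {K : ℝ → ℝ} (hV : 0 < varConst p K)
    (hB : biasConst p K ≠ 0) {f₀ fp : ℝ} {n : ℕ} (hf₀ : 0 < f₀) (hfp : fp ≠ 0) (hn : 1 ≤ n) :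
    asymMSE p K f₀ fp n (mseBandwidth p K f₀ fp n) =
      f₀ / n * (1 + 1 / (2 * p)) *
        (bandwidthConst p f₀ fp * n) ^ (1 / (2 * p + 1) : ℝ) * mseConst p K := by
  have hp' : (0 : ℝ) < p := by exact_mod_cast hp
  have hn' : (0 : ℝ) < n := by exact_mod_cast hn
  have hB2 : 0 < biasConst p K ^ 2 := by positivity
  have hβ : 0 < (fp / (p + 1).factorial) ^ 2 := by positivity
  have hC : 0 < bandwidthConst p f₀ fp := by unfold bandwidthConst; positivity
  set V := varConst p K with hVdef
  set b := biasConst p K with hbdef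
  set C := bandwidthConst p f₀ fp with hCdef
  have hden : 0 < C * b ^ 2 * n := by positivity
  have hh : mseBandwidth p K f₀ fp n = (V / (C * b ^ 2 * n)) ^ (1 / (2 * p + 1) : ℝ) := by
    rw [mseBandwidth, ← hVdef, ← hbdef, ← hCdef, neg_div, Real.rpow_neg hn'.le,
      ← Real.inv_rpow hn'.le, ← Real.mul_rpow (by positivity) (by positivity)]
    congr 1
    field_simp
  set h := mseBandwidth p K f₀ fp n with hhdef
  have hpos : 0 < h := by rw [hh]; positivity
  have hpow : h ^ (2 * p + 1) = V / (C * b ^ 2 * n) := by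
    rw [hh, ← Real.rpow_natCast, ← Real.rpow_mul (by positivity)]
    have : (1 / (2 * p + 1) : ℝ) * ((2 * p + 1 : ℕ) : ℝ) = 1 := by
      push_cast
      field_simp
    rw [this, Real.rpow_one]
  have hVh : V / h = (C * n) ^ (1 / (2 * p + 1) : ℝ) * mseConst p K := by
    rw [mseConst, ← hVdef, ← hbdef, ← mul_assoc,
      ← Real.mul_rpow (by positivity) (by positivity), hh,
      Real.div_rpow hV.le hden.le, div_div_eq_mul_div, mul_comm V, mul_div_assoc,
      show C * n * b ^ 2 = C * b ^ 2 * n by ring]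
    congr 1
    rw [div_eq_iff (by positivity), ← Real.rpow_add hV]
    rw [show (2 * p / (2 * p + 1) + 1 / (2 * p + 1) : ℝ) = 1 by field_simp, Real.rpow_one]
  have hbias : (h ^ p * (fp / (p + 1).factorial) * b) ^ 2 = f₀ / n * (1 / (2 * p)) * (V / h) := by
    have hβC : (fp / (p + 1).factorial) ^ 2 = C * f₀ / (2 * p) := by
      rw [hCdef, bandwidthConst]
      field_simp
    have : h ^ (2 * p) = V / (C * b ^ 2 * n) / h := by
      rw [← hpow, pow_succ]
      field_simp
    rw [mul_pow, mul_pow, ← pow_mul, mul_comm p 2, this, hβC]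
    have hb0 : b ≠ 0 := hB
    field_simp
  rw [asymMSE, asymBias, asymVar, ← hVdef, ← hbdef, hbias, mul_assoc (f₀ / n * _), ← hVh]
  field_simp
  ring

theorem minimality_of_constants {p : ℕ} (hp : 1 ≤ p) {L K : ℝ → ℝ}
    (hL : 0 < varConst p L) (hLK : varConst p L < varConst p K)
    (hB : biasConst p L ≠ 0)
    (h : biasConst p L ^ 2 * varConst p L ^ (2 * p) <
      biasConst p K ^ 2 * varConst p K ^ (2 * p)) :
    varConst p L < varConst p K ∧ mseConst p L < mseConst p K ∧
    (∀ (f₀ h : ℝ) (n : ℕ), 0 < f₀ → 0 < h → 1 ≤ n →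
      asymVar p L f₀ n h < asymVar p K f₀ n h) ∧
    (∀ (f₀ fp : ℝ) (n : ℕ), 0 < f₀ → fp ≠ 0 → 1 ≤ n →
      asymMSE p L f₀ fp n (mseBandwidth p L f₀ fp n) <
        asymMSE p K f₀ fp n (mseBandwidth p K f₀ fp n)) := by
  have hK : 0 < varConst p K := hL.trans hLK
  have hQ := mseConst_lt_mseConst hL hK h
  -- A vanishing bias would make the right side of `h` zero, while its left side is nonnegative.
  have hBK : biasConst p K ≠ 0 := by
    intro h0
    rw [h0, zero_pow two_ne_zero, zero_mul] at h
    exact absurd h (not_lt.mpr (by positivity))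
  refine ⟨hLK, hQ, fun f₀ h n hf₀ hh hn => ?_, fun f₀ fp n hf₀ hfp hn => ?_⟩
  · have hn' : (0 : ℝ) < n := by exact_mod_cast hn
    exact mul_lt_mul_of_pos_left hLK (by positivity)
  · have hn' : (0 : ℝ) < n := by exact_mod_cast hn
    have hp' : (0 : ℝ) < p := by exact_mod_cast hp
    rw [asymMSE_mseBandwidth hp hL hB hf₀ hfp hn, asymMSE_mseBandwidth hp hK hBK hf₀ hfp hn]
    have hC : 0 < bandwidthConst p f₀ fp := by unfold bandwidthConst; positivity
    exact mul_lt_mul_of_pos_left hQ (by positivity)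

end Comparison

open MeasureTheory Set Filter Topology

/-! ### Entries of `B` as one-dimensional integrals. -/

section DoubleIntegral

/-- The moments `∫_{-∞}^0 u^n K(u) du`. -/
noncomputable def moment (K : ℝ → ℝ) (n : ℕ) : ℝ := ∫ u in Iic (0 : ℝ), u ^ n * K u

theorem matA_apply (p : ℕ) (K : ℝ → ℝ) (i j : Fin (p + 1)) :
    matA p K i j = moment K (i + j) := by
  simp [matA, moment, monomials, pow_add]

theorem vecC_apply (p : ℕ) (K : ℝ → ℝ) (i : Fin (p + 1)) :
    vecC p K i = moment K (i + (p + 1)) := by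
  simp [vecC, moment, monomials, pow_add]

/-- Integration against `min u v` in terms of a second antiderivative of the density. -/
theorem integral_min_mul {f H H₁ : ℝ → ℝ} {v : ℝ} (hv : v ≤ 0)
    (hf : IntegrableOn f (Iic 0)) (hf' : IntegrableOn (fun u => u * f u) (Iic 0))
    (hH : ∀ u, HasDerivAt H (H₁ u) u) (hH₁c : Continuous H₁)
    (hH₁ : ∀ u ∈ Ioo v 0, HasDerivAt H₁ (f u) u) :
    ∫ u in Iic (0 : ℝ), min u v * f u =
      (∫ u in Iic (0 : ℝ), u * f u) + H 0 + v * H₁ 0 - H v := by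
  have hHc : Continuous H := continuous_iff_continuousAt.2 fun u => (hH u).continuousAt
  have hg : IntegrableOn (fun u => (u - v) * f u) (Iic 0) := by
    simp only [sub_mul]
    exact hf'.sub (hf.const_mul v)
  have hgv : IntegrableOn (fun u => (u - v) * f u) (Ioc v 0) :=
    hg.mono_set fun _ h => h.2
  -- This is `min u v = u - (u - v)⁺`; the positive part lives on `(v, 0]`.
  have hsplit : ∀ u ≤ 0, min u v * f u =
      u * f u - (Ioc v 0).indicator (fun u => (u - v) * f u) u := by
    intro u hu
    by_cases h1 : v < u
    · rw [min_eq_right h1.le, indicator_of_mem (show u ∈ Ioc v 0 from ⟨h1, hu⟩)]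
      ring
    · rw [min_eq_left (not_lt.1 h1), indicator_of_notMem (fun h => h1 h.1), sub_zero]
  have hfirst : ∫ u in Iic (0 : ℝ), min u v * f u =
      (∫ u in Iic (0 : ℝ), u * f u) - ∫ u in Ioc v 0, (u - v) * f u := by
    have hres : ∫ u in Ioc v 0, (u - v) * f u =
        ∫ u in Iic (0 : ℝ), (Ioc v 0).indicator (fun u => (u - v) * f u) u := by
      rw [setIntegral_indicator measurableSet_Ioc, inter_eq_right.2 fun _ h => h.2]
    rw [hres, ← integral_sub hf' (hg.indicator measurableSet_Ioc)]
    exact setIntegral_congr_fun measurableSet_Iic hsplit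
  -- Integration by parts: `(u - v) H₁ - H` is an antiderivative of `(u - v) f`.
  have hsecond : ∫ u in Ioc v 0, (u - v) * f u = H v - H 0 - v * H₁ 0 := by
    rw [← intervalIntegral.integral_of_le hv,
      intervalIntegral.integral_eq_sub_of_hasDerivAt_of_le
        (f := fun u => (u - v) * H₁ u - H u) hv (by fun_prop) (fun u hu => ?_)
        ((intervalIntegrable_iff_integrableOn_Ioc_of_le hv).2 hgv)]
    · simp only [sub_self, zero_mul, zero_sub]
      ring
    · have : HasDerivAt (fun u => (u - v) * H₁ u - H u) (1 * H₁ u + (u - v) * f u - H₁ u) u :=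
        (((hasDerivAt_id u).sub_const v).mul (hH₁ u hu)).sub (hH u)
      exact this.congr_deriv (by ring)
  rw [hfirst, hsecond]
  ring

/-- The outer factor `K v` kills every `v` outside the support. Hence `H₁` needs the right
derivative only on `(v, 0)` with `K v ≠ 0`, and a polynomial `H` can serve a truncated kernel. -/
theorem matB_apply {p : ℕ} {K H H₁ : ℝ → ℝ} {i j : Fin (p + 1)}
    (hK : ∀ n : ℕ, IntegrableOn (fun u => u ^ n * K u) (Iic 0))
    (hH : ∀ u, HasDerivAt H (H₁ u) u) (hH₁c : Continuous H₁)
    (hH₁ : ∀ v ≤ 0, K v ≠ 0 → ∀ u ∈ Ioo v 0, HasDerivAt H₁ (u ^ (i : ℕ) * K u) u)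
    (hHK : IntegrableOn (fun v => v ^ (j : ℕ) * K v * H v) (Iic 0)) :
    matB p K i j = (moment K (i + 1) + H 0) * moment K j + H₁ 0 * moment K (j + 1) -
      ∫ v in Iic (0 : ℝ), v ^ (j : ℕ) * K v * H v := by
  have hinner : ∀ v ∈ Iic (0 : ℝ), ∫ u in Iic (0 : ℝ),
      min u v * monomials p u i * monomials p v j * K u * K v =
      (moment K (i + 1) + H 0) * (v ^ (j : ℕ) * K v) + H₁ 0 * (v ^ ((j : ℕ) + 1) * K v) -
        v ^ (j : ℕ) * K v * H v := by
    intro v hv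
    by_cases h0 : K v = 0
    · simp [h0]
    have e1 : ∀ u, min u v * monomials p u i * monomials p v j * K u * K v =
        (v ^ (j : ℕ) * K v) * (min u v * (u ^ (i : ℕ) * K u)) := by
      intro u
      simp only [monomials]
      ring
    have e2 : ∀ u, u * (u ^ (i : ℕ) * K u) = u ^ ((i : ℕ) + 1) * K u := by
      intro u
      ring
    simp only [e1]
    rw [integral_const_mul, integral_min_mul hv (hK i) (by simpa only [e2] using hK (i + 1)) hH hH₁c
      (hH₁ v hv h0)]
    simp only [e2, moment]
    ring
  have h1 := (hK j).const_mul (moment K (i + 1) + H 0)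
  have h2 := (hK (j + 1)).const_mul (H₁ 0)
  have h12 : IntegrableOn (fun v => (moment K (i + 1) + H 0) * (v ^ (j : ℕ) * K v) +
      H₁ 0 * (v ^ ((j : ℕ) + 1) * K v)) (Iic 0) := h1.add h2
  rw [matB, Matrix.of_apply, setIntegral_congr_fun measurableSet_Iic hinner,
    integral_sub h12 hHK, integral_add h1 h2, integral_const_mul, integral_const_mul]
  rfl

end DoubleIntegral

/-! ### Explicit formulas for `p = 1, 2, 3` from a given solution of `A a = e₁`. -/

section Explicit

/-- The caller supplies `a`, so the linear system is only checked. Closed forms `M` and `N` on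
natural indices replace the integrals and leave pure arithmetic. -/
theorem constants_one {K : ℝ → ℝ} {M : ℕ → ℝ} {N : ℕ → ℕ → ℝ} (a₀ a₁ : ℝ)
    (hM : ∀ n, moment K n = M n)
    (hN : ∀ i j : Fin 2, matB 1 K i j = N i j)
    (hdet : M 0 * M 2 - M 1 * M 1 ≠ 0)
    (h₀ : a₀ * M 0 + a₁ * M 1 = 0) (h₁ : a₀ * M 1 + a₁ * M 2 = 1) :
    biasConst 1 K = a₀ * M 2 + a₁ * M 3 ∧
      varConst 1 K = a₀ * (a₀ * N 0 0 + a₁ * N 0 1) + a₁ * (a₀ * N 1 0 + a₁ * N 1 1) := by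
  have hA : matA 1 K = !![M 0, M 1; M 1, M 2] := by
    ext i j
    rw [matA_apply, hM]
    fin_cases i <;> fin_cases j <;> rfl
  have hB : matB 1 K = !![N 0 0, N 0 1; N 1 0, N 1 1] := by
    ext i j
    rw [hN]
    fin_cases i <;> fin_cases j <;> rfl
  have hc : vecC 1 K = ![M 2, M 3] := by
    ext i
    rw [vecC_apply, hM]
    fin_cases i <;> rfl
  have hd : (matA 1 K).det ≠ 0 := by
    rw [hA, Matrix.det_fin_two_of]
    exact hdet
  have ha : matA 1 K *ᵥ ![a₀, a₁] = e₁ 1 := by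
    rw [hA]
    ext i
    fin_cases i <;> simp [Matrix.mulVec, dotProduct, e₁] <;> linarith
  rw [biasConst_eq hd ha, varConst_eq hd ha, hB, hc]
  constructor
  · simp [dotProduct]
  · simp [Matrix.mulVec, dotProduct]
    ring

theorem constants_two {K : ℝ → ℝ} {M : ℕ → ℝ} {N : ℕ → ℕ → ℝ} (a₀ a₁ a₂ : ℝ)
    (hM : ∀ n, moment K n = M n)
    (hN : ∀ i j : Fin 3, matB 2 K i j = N i j)
    (hdet : M 0 * (M 2 * M 4 - M 3 * M 3) - M 1 * (M 1 * M 4 - M 3 * M 2) +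
      M 2 * (M 1 * M 3 - M 2 * M 2) ≠ 0)
    (h₀ : a₀ * M 0 + a₁ * M 1 + a₂ * M 2 = 0) (h₁ : a₀ * M 1 + a₁ * M 2 + a₂ * M 3 = 1)
    (h₂ : a₀ * M 2 + a₁ * M 3 + a₂ * M 4 = 0) :
    biasConst 2 K = a₀ * M 3 + a₁ * M 4 + a₂ * M 5 ∧
      varConst 2 K = a₀ * (a₀ * N 0 0 + a₁ * N 0 1 + a₂ * N 0 2) +
        a₁ * (a₀ * N 1 0 + a₁ * N 1 1 + a₂ * N 1 2) +
        a₂ * (a₀ * N 2 0 + a₁ * N 2 1 + a₂ * N 2 2) := by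
  have hA : matA 2 K = !![M 0, M 1, M 2; M 1, M 2, M 3; M 2, M 3, M 4] := by
    ext i j
    rw [matA_apply, hM]
    fin_cases i <;> fin_cases j <;> rfl
  have hB : matB 2 K = !![N 0 0, N 0 1, N 0 2; N 1 0, N 1 1, N 1 2; N 2 0, N 2 1, N 2 2] := by
    ext i j
    rw [hN]
    fin_cases i <;> fin_cases j <;> rfl
  have hc : vecC 2 K = ![M 3, M 4, M 5] := by
    ext i
    rw [vecC_apply, hM]
    fin_cases i <;> rfl
  have hd : (matA 2 K).det ≠ 0 := by
    rw [hA, Matrix.det_fin_three]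
    convert hdet using 1
    simp
    ring
  have ha : matA 2 K *ᵥ ![a₀, a₁, a₂] = e₁ 2 := by
    rw [hA]
    ext i
    fin_cases i <;> simp [Matrix.mulVec, dotProduct, Fin.sum_univ_succ, e₁] <;> linarith
  rw [biasConst_eq hd ha, varConst_eq hd ha, hB, hc]
  constructor <;> simp [Matrix.mulVec, dotProduct, Fin.sum_univ_succ] <;> ring

theorem constants_three {K : ℝ → ℝ} {M : ℕ → ℝ} {N : ℕ → ℕ → ℝ} (a₀ a₁ a₂ a₃ : ℝ)
    (hM : ∀ n, moment K n = M n)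
    (hN : ∀ i j : Fin 4, matB 3 K i j = N i j)
    (hdet : (!![M 0, M 1, M 2, M 3; M 1, M 2, M 3, M 4; M 2, M 3, M 4, M 5;
      M 3, M 4, M 5, M 6]).det ≠ 0)
    (h₀ : a₀ * M 0 + a₁ * M 1 + a₂ * M 2 + a₃ * M 3 = 0)
    (h₁ : a₀ * M 1 + a₁ * M 2 + a₂ * M 3 + a₃ * M 4 = 1)
    (h₂ : a₀ * M 2 + a₁ * M 3 + a₂ * M 4 + a₃ * M 5 = 0)
    (h₃ : a₀ * M 3 + a₁ * M 4 + a₂ * M 5 + a₃ * M 6 = 0) :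
    biasConst 3 K = a₀ * M 4 + a₁ * M 5 + a₂ * M 6 + a₃ * M 7 ∧
      varConst 3 K = a₀ * (a₀ * N 0 0 + a₁ * N 0 1 + a₂ * N 0 2 + a₃ * N 0 3) +
        a₁ * (a₀ * N 1 0 + a₁ * N 1 1 + a₂ * N 1 2 + a₃ * N 1 3) +
        a₂ * (a₀ * N 2 0 + a₁ * N 2 1 + a₂ * N 2 2 + a₃ * N 2 3) +
        a₃ * (a₀ * N 3 0 + a₁ * N 3 1 + a₂ * N 3 2 + a₃ * N 3 3) := by
  have hA : matA 3 K = !![M 0, M 1, M 2, M 3; M 1, M 2, M 3, M 4; M 2, M 3, M 4, M 5;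
      M 3, M 4, M 5, M 6] := by
    ext i j
    rw [matA_apply, hM]
    fin_cases i <;> fin_cases j <;> rfl
  have hB : matB 3 K = !![N 0 0, N 0 1, N 0 2, N 0 3; N 1 0, N 1 1, N 1 2, N 1 3;
      N 2 0, N 2 1, N 2 2, N 2 3; N 3 0, N 3 1, N 3 2, N 3 3] := by
    ext i j
    rw [hN]
    fin_cases i <;> fin_cases j <;> rfl
  have hc : vecC 3 K = ![M 4, M 5, M 6, M 7] := by
    ext i
    rw [vecC_apply, hM]
    fin_cases i <;> rfl
  have hd : (matA 3 K).det ≠ 0 := by rwa [hA]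
  have ha : matA 3 K *ᵥ ![a₀, a₁, a₂, a₃] = e₁ 3 := by
    rw [hA]
    ext i
    fin_cases i <;> simp [Matrix.mulVec, dotProduct, Fin.sum_univ_succ, e₁] <;> linarith
  rw [biasConst_eq hd ha, varConst_eq hd ha, hB, hc]
  constructor <;> simp [Matrix.mulVec, dotProduct, Fin.sum_univ_succ] <;> ring

/-- The determinant of a `4 × 4` Hankel matrix. -/
theorem det_hankel_four (a b c d e f g : ℝ) :
    (!![a, b, c, d; b, c, d, e; c, d, e, f; d, e, f, g]).det =
      a * (c * (e * g - f * f) - d * (d * g - f * e) + e * (d * f - e * e)) -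
      b * (b * (e * g - f * f) - d * (c * g - f * d) + e * (c * f - e * d)) +
      c * (b * (d * g - e * f) - c * (c * g - f * d) + e * (c * e - d * d)) -
      d * (b * (d * f - e * e) - c * (c * f - e * d) + d * (c * e - d * d)) := by
  rw [Matrix.det_succ_row_zero]
  simp [Fin.sum_univ_succ, Matrix.det_fin_three, Fin.succAbove, Matrix.submatrix]
  ring

end Explicit

/-! ### Kernels that are quadratic on `(-1, 0]`. -/

section CompactSupport

/-- `∫_{-1}^0 u^n du`. -/
noncomputable def unitMoment (n : ℕ) : ℝ := (-1) ^ n / (n + 1)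

theorem integral_pow_neg_one_zero (n : ℕ) :
    ∫ u in (-1 : ℝ)..0, u ^ n = unitMoment n := by
  rw [integral_pow, unitMoment, zero_pow (Nat.succ_ne_zero n), pow_succ]
  ring

variable {K : ℝ → ℝ} {c₀ c₁ c₂ : ℝ}

theorem integrableOn_mul_of_quadratic {g : ℝ → ℝ} (hg : Continuous g)
    (hK : ∀ u ≤ 0, K u = (Ioi (-1)).indicator (fun u => c₀ + c₁ * u + c₂ * u ^ 2) u) :
    IntegrableOn (fun u => g u * K u) (Iic 0) := by
  have h : IntegrableOn ((Ioi (-1)).indicator fun u => g u * (c₀ + c₁ * u + c₂ * u ^ 2))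
      (Iic (0 : ℝ)) := by
    rw [IntegrableOn, integrable_indicator_iff measurableSet_Ioi, IntegrableOn,
      Measure.restrict_restrict measurableSet_Ioi, Ioi_inter_Iic]
    exact (Continuous.integrableOn_Icc (by fun_prop)).mono_set Ioc_subset_Icc_self
  refine h.congr_fun (fun u hu => ?_) measurableSet_Iic
  simp only [hK u hu, indicator]
  split_ifs <;> simp

theorem integral_mul_of_quadratic (g : ℝ → ℝ)
    (hK : ∀ u ≤ 0, K u = (Ioi (-1)).indicator (fun u => c₀ + c₁ * u + c₂ * u ^ 2) u) :
    ∫ u in Iic (0 : ℝ), g u * K u = ∫ u in (-1 : ℝ)..0, g u * (c₀ + c₁ * u + c₂ * u ^ 2) := by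
  rw [intervalIntegral.integral_of_le (by norm_num), ← Ioi_inter_Iic, inter_comm,
    ← setIntegral_indicator measurableSet_Ioi]
  refine setIntegral_congr_fun measurableSet_Iic fun u hu => ?_
  simp only [hK u hu, indicator]
  split_ifs <;> simp

/-- Degree four is what `B` requires: after a power of `v` is split off, `H` and the kernel
contribute one quadratic factor each. -/
theorem integral_pow_mul_quartic (n : ℕ) (d₀ d₁ d₂ d₃ d₄ : ℝ) :
    ∫ u in (-1 : ℝ)..0, u ^ n * (d₀ + d₁ * u + d₂ * u ^ 2 + d₃ * u ^ 3 + d₄ * u ^ 4) =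
      d₀ * unitMoment n + d₁ * unitMoment (n + 1) + d₂ * unitMoment (n + 2) +
        d₃ * unitMoment (n + 3) + d₄ * unitMoment (n + 4) := by
  have h : ∀ u : ℝ, u ^ n * (d₀ + d₁ * u + d₂ * u ^ 2 + d₃ * u ^ 3 + d₄ * u ^ 4) =
      d₀ * u ^ n + d₁ * u ^ (n + 1) + d₂ * u ^ (n + 2) + d₃ * u ^ (n + 3) + d₄ * u ^ (n + 4) := by
    intro u
    ring
  have hi : ∀ (d : ℝ) (m : ℕ), IntervalIntegrable (fun u : ℝ => d * u ^ m) volume (-1) 0 :=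
    fun d m => Continuous.intervalIntegrable (by fun_prop) _ _
  simp only [h]
  rw [intervalIntegral.integral_add (Continuous.intervalIntegrable (by fun_prop) _ _) (hi _ _),
    intervalIntegral.integral_add (Continuous.intervalIntegrable (by fun_prop) _ _) (hi _ _),
    intervalIntegral.integral_add (Continuous.intervalIntegrable (by fun_prop) _ _) (hi _ _),
    intervalIntegral.integral_add (hi _ _) (hi _ _)]
  simp only [intervalIntegral.integral_const_mul, integral_pow_neg_one_zero]

/-- The moments of the density `c₀ + c₁ u + c₂ u²` on `(-1, 0]`. -/
noncomputable def quadMoment (c₀ c₁ c₂ : ℝ) (n : ℕ) : ℝ :=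
  c₀ * unitMoment n + c₁ * unitMoment (n + 1) + c₂ * unitMoment (n + 2)

theorem moment_of_quadratic
    (hK : ∀ u ≤ 0, K u = (Ioi (-1)).indicator (fun u => c₀ + c₁ * u + c₂ * u ^ 2) u) (n : ℕ) :
    moment K n = quadMoment c₀ c₁ c₂ n := by
  rw [moment, integral_mul_of_quadratic _ hK, quadMoment]
  simpa using integral_pow_mul_quartic n c₀ c₁ c₂ 0 0

/-- The entries of `B_{p,K}` for the density `c₀ + c₁ u + c₂ u²` on `(-1, 0]`. -/
noncomputable def quadMin (c₀ c₁ c₂ : ℝ) (i j : ℕ) : ℝ :=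
  quadMoment c₀ c₁ c₂ (i + 1) * quadMoment c₀ c₁ c₂ j -
    (c₀ / ((i + 1) * (i + 2)) * quadMoment c₀ c₁ c₂ (i + j + 2) +
      c₁ / ((i + 2) * (i + 3)) * quadMoment c₀ c₁ c₂ (i + j + 3) +
      c₂ / ((i + 3) * (i + 4)) * quadMoment c₀ c₁ c₂ (i + j + 4))

theorem matB_of_quadratic
    (hK : ∀ u ≤ 0, K u = (Ioi (-1)).indicator (fun u => c₀ + c₁ * u + c₂ * u ^ 2) u)
    {p : ℕ} (i j : Fin (p + 1)) : matB p K i j = quadMin c₀ c₁ c₂ i j := by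
  have hder : ∀ (c : ℝ) (n : ℕ) (u : ℝ),
      HasDerivAt (fun u => c / (n + 1) * u ^ (n + 1)) (c * u ^ n) u := by
    intro c n u
    refine ((hasDerivAt_pow (n + 1) u).const_mul (c / (n + 1))).congr_deriv ?_
    rw [Nat.add_sub_cancel]
    push_cast
    field_simp
  obtain ⟨i, hi⟩ := i
  obtain ⟨j, hj⟩ := j
  -- Antiderivatives normalized to vanish at `0`, so the boundary terms of `matB_apply` drop out.
  -- The casts are arranged so that `hder` applies verbatim.
  set H : ℝ → ℝ := fun u => c₀ / (i + 1) / ((i + 1 : ℕ) + 1) * u ^ (i + 1 + 1) +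
    c₁ / ((i + 1 : ℕ) + 1) / ((i + 2 : ℕ) + 1) * u ^ (i + 2 + 1) +
    c₂ / ((i + 2 : ℕ) + 1) / ((i + 3 : ℕ) + 1) * u ^ (i + 3 + 1) with hHdef
  set H₁ : ℝ → ℝ := fun u => c₀ / (i + 1) * u ^ (i + 1) +
    c₁ / ((i + 1 : ℕ) + 1) * u ^ (i + 1 + 1) + c₂ / ((i + 2 : ℕ) + 1) * u ^ (i + 2 + 1) with hH₁def
  have hH : ∀ u, HasDerivAt H (H₁ u) u := fun u =>
    ((hder _ (i + 1) u).add (hder _ (i + 2) u)).add (hder _ (i + 3) u)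
  have hH₁ : ∀ u, HasDerivAt H₁ (c₀ * u ^ i + c₁ * u ^ (i + 1) + c₂ * u ^ (i + 2)) u := fun u =>
    ((hder _ i u).add (hder _ (i + 1) u)).add (hder _ (i + 2) u)
  have hHc : Continuous H := by fun_prop
  have hcomm : ∀ v, v ^ j * K v * H v = v ^ j * H v * K v := fun v => by ring
  have hint : IntegrableOn (fun v => v ^ j * H v * K v) (Iic 0) :=
    integrableOn_mul_of_quadratic (by fun_prop) hK
  -- If `K v ≠ 0` then `v > -1`, so all of `(v, 0)` lies where `K` is the quadratic.
  have hpiece : ∀ v ≤ 0, K v ≠ 0 → ∀ u ∈ Ioo v 0, HasDerivAt H₁ (u ^ i * K u) u := by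
    intro v hv hKv u hu
    have hv1 : -1 < v := by
      by_contra h
      exact hKv (by rw [hK v hv, indicator_of_notMem (by simpa using h)])
    rw [hK u hu.2.le, indicator_of_mem (mem_Ioi.2 (hv1.trans hu.1))]
    exact (hH₁ u).congr_deriv (by ring)
  rw [matB_apply (H := H) (H₁ := H₁) (fun n => integrableOn_mul_of_quadratic (by fun_prop) hK) hH
    (by fun_prop) hpiece (by simpa only [hcomm] using hint)]
  simp only [hcomm]
  rw [integral_mul_of_quadratic _ hK]
  have hexp : ∀ v, v ^ j * H v * (c₀ + c₁ * v + c₂ * v ^ 2) =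
      v ^ (i + j + 2) * (c₀ / (i + 1) / (i + 2) * c₀ +
        (c₀ / (i + 1) / (i + 2) * c₁ + c₁ / (i + 2) / (i + 3) * c₀) * v +
        (c₀ / (i + 1) / (i + 2) * c₂ + c₁ / (i + 2) / (i + 3) * c₁ +
          c₂ / (i + 3) / (i + 4) * c₀) * v ^ 2 +
        (c₁ / (i + 2) / (i + 3) * c₂ + c₂ / (i + 3) / (i + 4) * c₁) * v ^ 3 +
        (c₂ / (i + 3) / (i + 4) * c₂) * v ^ 4) := by
    intro v
    rw [hHdef]
    push_cast
    rw [show (i : ℝ) + 1 + 1 = i + 2 by ring, show (i : ℝ) + 2 + 1 = i + 3 by ring,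
      show (i : ℝ) + 3 + 1 = i + 4 by ring]
    ring
  simp only [hexp]
  rw [integral_pow_mul_quartic]
  have h0 : H 0 = 0 := by simp [hHdef]
  have h10 : H₁ 0 = 0 := by simp [hH₁def]
  rw [h0, h10, moment_of_quadratic hK, moment_of_quadratic hK, quadMin]
  simp only [quadMoment, div_div]
  ring

end CompactSupport

/-! ### Exact constants of the triangular, uniform and Epanechnikov kernels. -/

section CompactKernels

theorem sq_lt_one_iff_of_nonpos {u : ℝ} (hu : u ≤ 0) : u ^ 2 < 1 ↔ -1 < u := by
  rw [sq_lt_one_iff_abs_lt_one, abs_of_nonpos hu, neg_lt]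

theorem triangular_of_nonpos (u : ℝ) (hu : u ≤ 0) :
    triangular u = (Ioi (-1)).indicator (fun u => 1 + 1 * u + 0 * u ^ 2) u := by
  simp only [triangular, indicator, mem_ofPred_eq, mem_Ioi, sq_lt_one_iff_of_nonpos hu,
    abs_of_nonpos hu]
  split_ifs
  · ring
  · rfl

theorem uniform_of_nonpos (u : ℝ) (hu : u ≤ 0) :
    uniform u = (Ioi (-1)).indicator (fun u => 1 / 2 + 0 * u + 0 * u ^ 2) u := by
  simp only [uniform, indicator, mem_ofPred_eq, mem_Ioi, sq_lt_one_iff_of_nonpos hu]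
  split_ifs
  · ring
  · rfl

theorem epanechnikov_of_nonpos (u : ℝ) (hu : u ≤ 0) :
    epanechnikov u = (Ioi (-1)).indicator (fun u => 3 / 4 + 0 * u + (-3 / 4) * u ^ 2) u := by
  simp only [epanechnikov, indicator, mem_ofPred_eq, mem_Ioi, sq_lt_one_iff_of_nonpos hu]
  split_ifs
  · ring
  · rfl

theorem triangular_constants_one :
    biasConst 1 triangular = -4 / 5 ∧ varConst 1 triangular = 48 / 35 := by
  -- The numbers `12, 36` solve `A a = e₁`; the numerical arguments in the lemmas below have the
  -- same origin.
  have h := constants_one 12 36 (moment_of_quadratic triangular_of_nonpos)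
    (matB_of_quadratic triangular_of_nonpos)
    (by norm_num [quadMoment, unitMoment]) (by norm_num [quadMoment, unitMoment])
    (by norm_num [quadMoment, unitMoment])
  rw [h.1, h.2]
  constructor <;> norm_num [quadMin, quadMoment, unitMoment]

theorem triangular_constants_two :
    biasConst 2 triangular = -3 / 7 ∧ varConst 2 triangular = 40 / 7 := by
  have h := constants_two 60 420 480 (moment_of_quadratic triangular_of_nonpos)
    (matB_of_quadratic triangular_of_nonpos)
    (by norm_num [quadMoment, unitMoment]) (by norm_num [quadMoment, unitMoment])
    (by norm_num [quadMoment, unitMoment]) (by norm_num [quadMoment, unitMoment])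
  rw [h.1, h.2]
  constructor <;> norm_num [quadMin, quadMoment, unitMoment]

theorem triangular_constants_three :
    biasConst 3 triangular = -4 / 21 ∧ varConst 3 triangular = 1080 / 77 := by
  have h := constants_three 180 2220 5880 4200 (moment_of_quadratic triangular_of_nonpos)
    (matB_of_quadratic triangular_of_nonpos)
    (by rw [det_hankel_four]; norm_num [quadMoment, unitMoment])
    (by norm_num [quadMoment, unitMoment]) (by norm_num [quadMoment, unitMoment])
    (by norm_num [quadMoment, unitMoment]) (by norm_num [quadMoment, unitMoment])
  rw [h.1, h.2]
  constructor <;> norm_num [quadMin, quadMoment, unitMoment]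

theorem uniform_constants_one :
    biasConst 1 uniform = -1 ∧ varConst 1 uniform = 6 / 5 := by
  have h := constants_one 12 24 (moment_of_quadratic uniform_of_nonpos)
    (matB_of_quadratic uniform_of_nonpos)
    (by norm_num [quadMoment, unitMoment]) (by norm_num [quadMoment, unitMoment])
    (by norm_num [quadMoment, unitMoment])
  rw [h.1, h.2]
  constructor <;> norm_num [quadMin, quadMoment, unitMoment]

theorem uniform_constants_two :
    biasConst 2 uniform = -3 / 5 ∧ varConst 2 uniform = 192 / 35 := by
  have h := constants_two 72 384 360 (moment_of_quadratic uniform_of_nonpos)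
    (matB_of_quadratic uniform_of_nonpos)
    (by norm_num [quadMoment, unitMoment]) (by norm_num [quadMoment, unitMoment])
    (by norm_num [quadMoment, unitMoment]) (by norm_num [quadMoment, unitMoment])
  rw [h.1, h.2]
  constructor <;> norm_num [quadMin, quadMoment, unitMoment]

theorem uniform_constants_three :
    biasConst 3 uniform = -2 / 7 ∧ varConst 3 uniform = 100 / 7 := by
  have h := constants_three 240 2400 5400 3360 (moment_of_quadratic uniform_of_nonpos)
    (matB_of_quadratic uniform_of_nonpos)
    (by rw [det_hankel_four]; norm_num [quadMoment, unitMoment])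
    (by norm_num [quadMoment, unitMoment]) (by norm_num [quadMoment, unitMoment])
    (by norm_num [quadMoment, unitMoment]) (by norm_num [quadMoment, unitMoment])
  rw [h.1, h.2]
  constructor <;> norm_num [quadMin, quadMoment, unitMoment]

theorem epanechnikov_constants_one :
    biasConst 1 epanechnikov = -16 / 19 ∧ varConst 1 epanechnikov = 3400 / 2527 := by
  have h := constants_one (240 / 19) (640 / 19) (moment_of_quadratic epanechnikov_of_nonpos)
    (matB_of_quadratic epanechnikov_of_nonpos)
    (by norm_num [quadMoment, unitMoment]) (by norm_num [quadMoment, unitMoment])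
    (by norm_num [quadMoment, unitMoment])
  rw [h.1, h.2]
  constructor <;> norm_num [quadMin, quadMoment, unitMoment]

theorem epanechnikov_constants_two :
    biasConst 2 epanechnikov = -13 / 28 ∧ varConst 2 epanechnikov = 4000 / 693 := by
  have h := constants_two (200 / 3) (1280 / 3) (1400 / 3) (moment_of_quadratic epanechnikov_of_nonpos)
    (matB_of_quadratic epanechnikov_of_nonpos)
    (by norm_num [quadMoment, unitMoment]) (by norm_num [quadMoment, unitMoment])
    (by norm_num [quadMoment, unitMoment]) (by norm_num [quadMoment, unitMoment])
  rw [h.1, h.2]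
  constructor <;> norm_num [quadMin, quadMoment, unitMoment]

theorem epanechnikov_constants_three :
    biasConst 3 epanechnikov = -316 / 1503 ∧ varConst 3 epanechnikov = 39945640 / 2761011 := by
  have h := constants_three (103600 / 501) (1187200 / 501) (3018400 / 501) (698880 / 167) (moment_of_quadratic epanechnikov_of_nonpos)
    (matB_of_quadratic epanechnikov_of_nonpos)
    (by rw [det_hankel_four]; norm_num [quadMoment, unitMoment])
    (by norm_num [quadMoment, unitMoment]) (by norm_num [quadMoment, unitMoment])
    (by norm_num [quadMoment, unitMoment]) (by norm_num [quadMoment, unitMoment])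
  rw [h.1, h.2]
  constructor <;> norm_num [quadMin, quadMoment, unitMoment]

end CompactKernels

/-! ### Moments of exponential-power densities on the negative half-line. -/

section HalfLineMoments

theorem integrableOn_Iic_of_comp_neg {f : ℝ → ℝ} (hf : IntegrableOn f (Ioi 0)) :
    IntegrableOn (fun u => f (-u)) (Iic 0) := by
  rw [integrableOn_Iic_iff_integrableOn_Iio]
  have := (Measure.measurePreserving_neg (volume : Measure ℝ)).integrableOn_comp_preimage
    (MeasurableEquiv.neg ℝ).measurableEmbedding (f := f) (s := Ioi 0)
  simpa [Function.comp_def] using this.2 hf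

/-- Reflection moves the claim to the positive half-line. The exponent `m = 1` serves the
spline-type kernel and `m = 2` the Gaussian. -/
theorem integrableOn_pow_mul_exp_neg_mul_abs_pow {m : ℕ} (hm : 0 < m) {b : ℝ} (hb : 0 < b)
    (n : ℕ) : IntegrableOn (fun u : ℝ => u ^ n * Real.exp (-b * |u| ^ m)) (Iic 0) := by
  have h : IntegrableOn (fun u : ℝ => (-1) ^ n * (u ^ (n : ℝ) * Real.exp (-b * u ^ (m : ℝ))))
      (Ioi 0) :=
    (integrableOn_rpow_mul_exp_neg_mul_rpow (by have := n.cast_nonneg (α := ℝ); linarith)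
      (by exact_mod_cast hm) hb).const_mul _
  refine (integrableOn_Iic_of_comp_neg h).congr_fun (fun u hu => ?_) measurableSet_Iic
  simp only [Real.rpow_natCast]
  rw [abs_of_nonpos hu, ← mul_assoc, ← mul_pow, neg_one_mul, neg_neg]

theorem integral_pow_mul_exp_neg_mul_abs_pow {m : ℕ} (hm : 0 < m) {b : ℝ} (hb : 0 < b)
    (n : ℕ) : ∫ u in Iic (0 : ℝ), u ^ n * Real.exp (-b * |u| ^ m) =
      (-1) ^ n * (b ^ (-((n : ℝ) + 1) / m) * (1 / m) * Real.Gamma (((n : ℝ) + 1) / m)) := by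
  have h := integral_rpow_mul_exp_neg_mul_rpow (p := m) (q := n) (by exact_mod_cast hm)
    (by have := n.cast_nonneg (α := ℝ); linarith) hb
  rw [← h, ← integral_const_mul]
  have h' := integral_comp_neg_Iic (0 : ℝ)
    (fun u : ℝ => (-1) ^ n * (u ^ (n : ℝ) * Real.exp (-b * u ^ (m : ℝ))))
  rw [neg_zero] at h'
  rw [← h']
  refine setIntegral_congr_fun measurableSet_Iic fun u hu => ?_
  simp only [Real.rpow_natCast]
  rw [abs_of_nonpos hu, ← mul_assoc, ← mul_pow, neg_one_mul, neg_neg]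

theorem integrableOn_pow_mul_exp_mul {b : ℝ} (hb : 0 < b) (n : ℕ) :
    IntegrableOn (fun u : ℝ => u ^ n * Real.exp (b * u)) (Iic 0) := by
  refine (integrableOn_pow_mul_exp_neg_mul_abs_pow one_pos hb n).congr_fun (fun u hu => ?_)
    measurableSet_Iic
  simp only [pow_one, abs_of_nonpos (mem_Iic.1 hu), neg_mul_neg]

theorem integral_pow_mul_exp_mul {b : ℝ} (hb : 0 < b) (n : ℕ) :
    ∫ u in Iic (0 : ℝ), u ^ n * Real.exp (b * u) = (-1) ^ n * n.factorial / b ^ (n + 1) := by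
  have h := integral_pow_mul_exp_neg_mul_abs_pow one_pos hb n
  rw [setIntegral_congr_fun (g := fun u => u ^ n * Real.exp (b * u)) measurableSet_Iic
    (fun u hu => by simp only [pow_one, abs_of_nonpos (mem_Iic.1 hu), neg_mul_neg])] at h
  rw [h, Nat.cast_one, div_one, div_one, div_one, Real.Gamma_nat_eq_factorial,
    Real.rpow_neg hb.le, show (n : ℝ) + 1 = ((n + 1 : ℕ) : ℝ) by push_cast; rfl,
    Real.rpow_natCast]
  ring

end HalfLineMoments

/-! ### Exact constants of the spline-type kernel. -/

section Spline

theorem spline_of_nonpos {u : ℝ} (hu : u ≤ 0) : spline u = Real.exp (1 * u) / 2 := by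
  rw [spline, abs_of_nonpos hu, neg_neg, one_mul]

theorem integrableOn_pow_mul_spline (n : ℕ) :
    IntegrableOn (fun u => u ^ n * spline u) (Iic 0) := by
  have h : IntegrableOn (fun u : ℝ => u ^ n * Real.exp (1 * u) / 2) (Iic 0) :=
    (integrableOn_pow_mul_exp_mul one_pos n).div_const 2
  refine h.congr_fun (fun u hu => ?_) measurableSet_Iic
  simp only [spline_of_nonpos hu, mul_div_assoc]

theorem moment_spline (n : ℕ) : moment spline n = (-1) ^ n * n.factorial / 2 := by
  have h : ∀ u ∈ Iic (0 : ℝ), u ^ n * spline u = u ^ n * Real.exp (1 * u) / 2 := fun u hu => by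
    rw [spline_of_nonpos hu, mul_div_assoc]
  rw [moment, setIntegral_congr_fun measurableSet_Iic h, integral_div,
    integral_pow_mul_exp_mul one_pos, one_pow, div_one]

/-- The polynomial factor of a second antiderivative of `u^i e^u` is
`∑ k, splineCoeff i k * u ^ k`. -/
noncomputable def splineCoeff (i k : ℕ) : ℝ :=
  i.choose k * (-1) ^ (i - k) * (i - k + 1).factorial

/-- The entries of `B_{p,K}` for the spline-type kernel and `p ≤ 3`. -/
noncomputable def splineMin (i j : ℕ) : ℝ :=
  ((-1) ^ i * i.factorial * ((-1) ^ (j + 1) * (j + 1).factorial) -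
    (splineCoeff i 0 * ((-1) ^ j * j.factorial / 2 ^ (j + 1)) +
      splineCoeff i 1 * ((-1) ^ (j + 1) * (j + 1).factorial / 2 ^ (j + 2)) +
      splineCoeff i 2 * ((-1) ^ (j + 2) * (j + 2).factorial / 2 ^ (j + 3)) +
      splineCoeff i 3 * ((-1) ^ (j + 3) * (j + 3).factorial / 2 ^ (j + 4)))) / 4

/-- On polynomials times `e^u`, differentiation acts as `1 + D` on the polynomial and preserves the
cubic form, so the lemma can be applied twice. -/
theorem hasDerivAt_cubic_mul_exp (d₀ d₁ d₂ d₃ u : ℝ) :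
    HasDerivAt (fun u => (d₀ + d₁ * u + d₂ * u ^ 2 + d₃ * u ^ 3) * (Real.exp u / 2))
      (((d₀ + d₁) + (d₁ + 2 * d₂) * u + (d₂ + 3 * d₃) * u ^ 2 + d₃ * u ^ 3) *
        (Real.exp u / 2)) u := by
  have h : HasDerivAt (fun u : ℝ => (d₀ + d₁ * u + d₂ * u ^ 2 + d₃ * u ^ 3) * (Real.exp u / 2))
      ((d₁ * 1 + d₂ * ((2 : ℕ) * u ^ (2 - 1)) + d₃ * ((3 : ℕ) * u ^ (3 - 1))) * (Real.exp u / 2) +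
        (d₀ + d₁ * u + d₂ * u ^ 2 + d₃ * u ^ 3) * (Real.exp u / 2)) u :=
    (((((hasDerivAt_id u).const_mul d₁).const_add d₀).add ((hasDerivAt_pow 2 u).const_mul d₂)).add
      ((hasDerivAt_pow 3 u).const_mul d₃)).mul ((Real.hasDerivAt_exp u).div_const 2)
  refine h.congr_deriv ?_
  push_cast
  ring

/-- The polynomial factor of the second antiderivative is `(1 + D)⁻² u^i = ∑ (-1)^m (m + 1) D^m
u^i`, a finite sum with the coefficients `splineCoeff`. It has degree at most three because `i ≤ 3`.
-/
theorem matB_spline {p : ℕ} (hp : p ≤ 3) (i j : Fin (p + 1)) :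
    matB p spline i j = splineMin i j := by
  obtain ⟨i, hi⟩ := i
  obtain ⟨j, hj⟩ := j
  obtain ⟨d₀, hd₀⟩ : ∃ d, d = splineCoeff i 0 := ⟨_, rfl⟩
  obtain ⟨d₁, hd₁⟩ : ∃ d, d = splineCoeff i 1 := ⟨_, rfl⟩
  obtain ⟨d₂, hd₂⟩ : ∃ d, d = splineCoeff i 2 := ⟨_, rfl⟩
  obtain ⟨d₃, hd₃⟩ : ∃ d, d = splineCoeff i 3 := ⟨_, rfl⟩
  have hi3 : i ≤ 3 := by omega
  have hH := fun u => hasDerivAt_cubic_mul_exp d₀ d₁ d₂ d₃ u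
  have hH₁ := fun u => hasDerivAt_cubic_mul_exp (d₀ + d₁) (d₁ + 2 * d₂) (d₂ + 3 * d₃) d₃ u
  have hrepr : ∀ v ∈ Iic (0 : ℝ),
      v ^ j * spline v * ((d₀ + d₁ * v + d₂ * v ^ 2 + d₃ * v ^ 3) * (Real.exp v / 2)) =
      (d₀ / 4 * (v ^ j * Real.exp (2 * v)) + d₁ / 4 * (v ^ (j + 1) * Real.exp (2 * v))) +
      (d₂ / 4 * (v ^ (j + 2) * Real.exp (2 * v)) + d₃ / 4 * (v ^ (j + 3) * Real.exp (2 * v))) := by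
    intro v hv
    rw [spline_of_nonpos hv, one_mul, two_mul v, Real.exp_add]
    ring
  have hE := fun (d : ℝ) (n : ℕ) => (integrableOn_pow_mul_exp_mul two_pos n).const_mul d
  have hE₀₁ : IntegrableOn (fun v : ℝ => d₀ / 4 * (v ^ j * Real.exp (2 * v)) +
      d₁ / 4 * (v ^ (j + 1) * Real.exp (2 * v))) (Iic 0) := (hE _ _).add (hE _ _)
  have hE₂₃ : IntegrableOn (fun v : ℝ => d₂ / 4 * (v ^ (j + 2) * Real.exp (2 * v)) +
      d₃ / 4 * (v ^ (j + 3) * Real.exp (2 * v))) (Iic 0) := (hE _ _).add (hE _ _)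
  have hpiece : ∀ v ≤ 0, spline v ≠ 0 → ∀ u ∈ Ioo v 0, HasDerivAt (fun u =>
      ((d₀ + d₁) + (d₁ + 2 * d₂) * u + (d₂ + 3 * d₃) * u ^ 2 + d₃ * u ^ 3) * (Real.exp u / 2))
      (u ^ i * spline u) u := by
    intro v _ _ u hu
    refine (hH₁ u).congr_deriv ?_
    rw [spline_of_nonpos hu.2.le, one_mul, hd₀, hd₁, hd₂, hd₃]
    congr 1
    interval_cases i <;> simp [splineCoeff, Nat.factorial, Nat.choose] <;> ring
  rw [matB_apply integrableOn_pow_mul_spline hH (by fun_prop) hpiece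
    ((hE₀₁.add hE₂₃).congr_fun (fun v hv => (hrepr v hv).symm) measurableSet_Iic),
    setIntegral_congr_fun measurableSet_Iic hrepr, integral_add hE₀₁ hE₂₃,
    integral_add (hE _ _) (hE _ _), integral_add (hE _ _) (hE _ _)]
  simp only [integral_const_mul, integral_pow_mul_exp_mul two_pos, moment_spline]
  rw [splineMin, ← hd₀, ← hd₁, ← hd₂, ← hd₃]
  -- These antiderivatives vanish at `-∞`, so `H 0` cancels the moment of order `i + 1`, and `H₁ 0`
  -- is the moment of order `i`.
  have h0 : (-1) ^ (i + 1) * ((i + 1).factorial : ℝ) + d₀ = 0 := by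
    rw [hd₀, splineCoeff, pow_succ]
    simp
  have h1 : d₀ + d₁ = (-1) ^ i * i.factorial := by
    rw [hd₀, hd₁]
    interval_cases i <;> norm_num [splineCoeff, Nat.factorial]
  simp only [mul_zero, add_zero, Real.exp_zero, ne_eq, OfNat.ofNat_ne_zero, not_false_eq_true,
    zero_pow]
  rw [show (-1) ^ (i + 1) * ((i + 1).factorial : ℝ) / 2 + d₀ * (1 / 2) = 0 by linarith, h1]
  ring

theorem spline_constants_one : biasConst 1 spline = -4 ∧ varConst 1 spline = 1 / 4 := by
  have h := constants_one 2 2 moment_spline (matB_spline (by norm_num))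
    (by norm_num [Nat.factorial]) (by norm_num [Nat.factorial]) (by norm_num [Nat.factorial])
  rw [h.1, h.2]
  constructor <;> norm_num [splineMin, splineCoeff, Nat.factorial, Nat.choose]

theorem spline_constants_two : biasConst 2 spline = -18 ∧ varConst 2 spline = 3 / 4 := by
  have h := constants_two 6 10 2 moment_spline (matB_spline (by norm_num))
    (by norm_num [Nat.factorial]) (by norm_num [Nat.factorial]) (by norm_num [Nat.factorial])
    (by norm_num [Nat.factorial])
  rw [h.1, h.2]
  constructor <;> norm_num [splineMin, splineCoeff, Nat.factorial, Nat.choose]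

theorem spline_constants_three : biasConst 3 spline = -96 ∧ varConst 3 spline = 45 / 32 := by
  have h := constants_three 12 28 11 1 moment_spline (matB_spline (by norm_num))
    (by rw [det_hankel_four]; norm_num [Nat.factorial])
    (by norm_num [Nat.factorial]) (by norm_num [Nat.factorial]) (by norm_num [Nat.factorial])
    (by norm_num [Nat.factorial])
  rw [h.1, h.2]
  constructor <;> norm_num [splineMin, splineCoeff, Nat.factorial, Nat.choose]

end Spline

/-! ### Moments of the Gaussian kernel and of its square. -/

section GaussianMoments

theorem integrableOn_pow_mul_exp_neg_mul_sq {b : ℝ} (hb : 0 < b) (n : ℕ) :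
    IntegrableOn (fun u : ℝ => u ^ n * Real.exp (-b * u ^ 2)) (Iic 0) := by
  simpa only [sq_abs] using integrableOn_pow_mul_exp_neg_mul_abs_pow two_pos hb n

theorem integral_exp_neg_mul_sq (b : ℝ) :
    ∫ u in Iic (0 : ℝ), u ^ 0 * Real.exp (-b * u ^ 2) = Real.sqrt (Real.pi / b) / 2 := by
  have h := integral_comp_neg_Iic (0 : ℝ) (fun u : ℝ => Real.exp (-b * u ^ 2))
  rw [neg_zero, integral_gaussian_Ioi] at h
  simpa using h

theorem integral_mul_exp_neg_mul_sq {b : ℝ} (hb : 0 < b) :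
    ∫ u in Iic (0 : ℝ), u ^ 1 * Real.exp (-b * u ^ 2) = -(1 / (2 * b)) := by
  have h := integral_pow_mul_exp_neg_mul_abs_pow two_pos hb 1
  simp only [sq_abs] at h
  rw [h]
  norm_num [Real.rpow_neg_one]

/-- The functional equation `Γ(x + 1) = x Γ(x)`; it drives the recursions for `gaussMoment` and
`gaussSqMoment`. -/
theorem integral_pow_add_two_mul_exp_neg_mul_sq {b : ℝ} (hb : 0 < b) (n : ℕ) :
    ∫ u in Iic (0 : ℝ), u ^ (n + 2) * Real.exp (-b * u ^ 2) =
      (n + 1) / (2 * b) * ∫ u in Iic (0 : ℝ), u ^ n * Real.exp (-b * u ^ 2) := by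
  have h := integral_pow_mul_exp_neg_mul_abs_pow two_pos hb
  simp only [sq_abs] at h
  rw [h, h]
  have hn : ((n : ℝ) + 1) / 2 ≠ 0 := by positivity
  have e1 : (((n + 2 : ℕ) : ℝ) + 1) / (2 : ℕ) = ((n : ℝ) + 1) / 2 + 1 := by
    push_cast
    ring
  have e2 : -(((n + 2 : ℕ) : ℝ) + 1) / (2 : ℕ) = -((n : ℝ) + 1) / 2 - 1 := by
    push_cast
    ring
  rw [e1, e2, Real.Gamma_add_one hn, Real.rpow_sub_one hb.ne', pow_add]
  push_cast
  field_simp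

/-- The value of the standard Gaussian density at the origin. -/
noncomputable def gaussPeak : ℝ := 1 / Real.sqrt (2 * Real.pi)

/-- The moments of the Gaussian kernel on the negative half-line. -/
noncomputable def gaussMoment : ℕ → ℝ
  | 0 => 1 / 2
  | 1 => -gaussPeak
  | n + 2 => (n + 1) * gaussMoment n

/-- `1 / (4 √π)`, the integral of the squared Gaussian density over the negative half-line. -/
noncomputable def gaussSqMass : ℝ := 1 / (4 * Real.sqrt Real.pi)

/-- The moments of the squared Gaussian kernel on the negative half-line. -/
noncomputable def gaussSqMoment : ℕ → ℝ
  | 0 => gaussSqMass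
  | 1 => -gaussPeak ^ 2 / 2
  | n + 2 => (n + 1) / 2 * gaussSqMoment n

theorem gaussPeak_sq : gaussPeak ^ 2 = 1 / (2 * Real.pi) := by
  rw [gaussPeak, div_pow, Real.sq_sqrt (by positivity), one_pow]

theorem gaussian_eq (u : ℝ) : gaussian u = gaussPeak * Real.exp (-(1 / 2) * u ^ 2) := by
  rw [gaussian, gaussPeak, show -u ^ 2 / 2 = -(1 / 2) * u ^ 2 by ring]
  ring

theorem gaussian_sq_eq (u : ℝ) :
    gaussian u * gaussian u = gaussPeak ^ 2 * Real.exp (-1 * u ^ 2) := by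
  rw [gaussian_eq, show -1 * u ^ 2 = -(1 / 2) * u ^ 2 + -(1 / 2) * u ^ 2 by ring, Real.exp_add]
  ring

theorem gaussian_zero : gaussian 0 = gaussPeak := by simp [gaussian_eq]

theorem gaussian_nonneg (u : ℝ) : 0 ≤ gaussian u := by
  rw [gaussian]
  positivity

theorem continuous_gaussian : Continuous gaussian := by
  unfold gaussian
  fun_prop

theorem hasDerivAt_gaussian (u : ℝ) : HasDerivAt gaussian (-u * gaussian u) u := by
  have h : HasDerivAt (fun u : ℝ => -u ^ 2 / 2) (-((2 : ℕ) * u ^ (2 - 1)) / 2) u :=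
    (hasDerivAt_pow 2 u).neg.div_const 2
  have h' : HasDerivAt gaussian
      (Real.exp (-u ^ 2 / 2) * (-((2 : ℕ) * u ^ (2 - 1)) / 2) / Real.sqrt (2 * Real.pi)) u :=
    h.exp.div_const _
  refine h'.congr_deriv ?_
  rw [gaussian]
  push_cast
  ring

theorem integrableOn_pow_mul_gaussian (n : ℕ) :
    IntegrableOn (fun u => u ^ n * gaussian u) (Iic 0) := by
  simp only [gaussian_eq, mul_left_comm _ gaussPeak]
  exact (integrableOn_pow_mul_exp_neg_mul_sq one_half_pos n).const_mul _

theorem moment_gaussian (n : ℕ) : moment gaussian n = gaussMoment n := by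
  have hm : ∀ n, moment gaussian n =
      gaussPeak * ∫ u in Iic (0 : ℝ), u ^ n * Real.exp (-(1 / 2) * u ^ 2) := by
    intro n
    simp only [moment, gaussian_eq, mul_left_comm _ gaussPeak]
    exact integral_const_mul _ _
  induction n using Nat.twoStepInduction with
  | zero =>
    rw [hm, integral_exp_neg_mul_sq, gaussMoment, gaussPeak,
      show Real.pi / (1 / 2) = 2 * Real.pi by ring]
    have : Real.sqrt (2 * Real.pi) ≠ 0 := by positivity
    field_simp
  | one =>
    rw [hm, integral_mul_exp_neg_mul_sq one_half_pos, gaussMoment]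
    ring
  | more n ih _ =>
    rw [hm, integral_pow_add_two_mul_exp_neg_mul_sq one_half_pos, gaussMoment, ← ih, hm]
    ring

theorem integrableOn_pow_mul_gaussian_sq (n : ℕ) :
    IntegrableOn (fun u => u ^ n * (gaussian u * gaussian u)) (Iic 0) := by
  simp only [gaussian_sq_eq, mul_left_comm _ (gaussPeak ^ 2)]
  exact (integrableOn_pow_mul_exp_neg_mul_sq one_pos n).const_mul _

theorem integral_pow_mul_gaussian_sq (n : ℕ) :
    ∫ u in Iic (0 : ℝ), u ^ n * (gaussian u * gaussian u) = gaussSqMoment n := by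
  have hm : ∀ n : ℕ, ∫ u in Iic (0 : ℝ), u ^ n * (gaussian u * gaussian u) =
      gaussPeak ^ 2 * ∫ u in Iic (0 : ℝ), u ^ n * Real.exp (-1 * u ^ 2) := by
    intro n
    simp only [gaussian_sq_eq, mul_left_comm _ (gaussPeak ^ 2)]
    exact integral_const_mul _ _
  induction n using Nat.twoStepInduction with
  | zero =>
    rw [hm, integral_exp_neg_mul_sq, gaussSqMoment, gaussSqMass, gaussPeak_sq, div_one]
    have h := Real.sq_sqrt Real.pi_pos.le
    field_simp
    nlinarith
  | one =>
    rw [hm, integral_mul_exp_neg_mul_sq one_pos, gaussSqMoment]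
    ring
  | more n ih _ =>
    rw [hm, integral_pow_add_two_mul_exp_neg_mul_sq one_pos, gaussSqMoment, ← ih, hm]
    ring

end GaussianMoments

/-! ### Moments of the Gaussian kernel times the Gaussian mass of `[v, 0]`. -/

section GaussianTail

/-- The Gaussian mass of `[v, 0]`. -/
noncomputable def gaussMass (v : ℝ) : ℝ := ∫ t in v..0, gaussian t

theorem gaussMass_zero : gaussMass 0 = 0 := intervalIntegral.integral_same

theorem hasDerivAt_gaussMass (v : ℝ) : HasDerivAt gaussMass (-gaussian v) v :=
  intervalIntegral.integral_hasDerivAt_left (continuous_gaussian.intervalIntegrable _ _)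
    (continuous_gaussian.stronglyMeasurableAtFilter _ _) continuous_gaussian.continuousAt

theorem continuous_gaussMass : Continuous gaussMass :=
  continuous_iff_continuousAt.2 fun v => (hasDerivAt_gaussMass v).continuousAt

theorem integral_gaussian_Iic : ∫ u in Iic (0 : ℝ), gaussian u = 1 / 2 := by
  simpa [moment, gaussMoment] using moment_gaussian 0

theorem integrableOn_gaussian : IntegrableOn gaussian (Iic 0) := by
  simpa using integrableOn_pow_mul_gaussian 0

theorem tendsto_gaussMass : Tendsto gaussMass atBot (𝓝 (1 / 2)) := by
  rw [← integral_gaussian_Iic]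
  exact intervalIntegral_tendsto_integral_Iic 0 integrableOn_gaussian tendsto_id

theorem norm_gaussMass_le {v : ℝ} (hv : v ≤ 0) : ‖gaussMass v‖ ≤ 1 / 2 := by
  rw [gaussMass, intervalIntegral.integral_of_le hv, Real.norm_of_nonneg
    (integral_nonneg fun u => gaussian_nonneg u), ← integral_gaussian_Iic]
  exact setIntegral_mono_set integrableOn_gaussian
    (Eventually.of_forall fun u => gaussian_nonneg u) (Eventually.of_forall fun u hu => hu.2)

theorem integrableOn_pow_mul_gaussian_mul_gaussMass (n : ℕ) :
    IntegrableOn (fun v => v ^ n * (gaussian v * gaussMass v)) (Iic 0) := by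
  have h : IntegrableOn (fun v => v ^ n * gaussian v * gaussMass v) (Iic 0) :=
    (integrableOn_pow_mul_gaussian n).mul_bdd continuous_gaussMass.aestronglyMeasurable
      ((ae_restrict_iff' measurableSet_Iic).2 (Eventually.of_forall fun v => norm_gaussMass_le))
  simpa only [mul_assoc] using h

/-- The integral of `v ^ n` against the product of the Gaussian kernel and `gaussMass`. -/
noncomputable def gaussMassMoment : ℕ → ℝ
  | 0 => 1 / 8
  | 1 => -gaussSqMass
  | n + 2 => (n + 1) * gaussMassMoment n - gaussSqMoment (n + 1)

theorem hasDerivAt_gaussian_mul_gaussMass (v : ℝ) :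
    HasDerivAt (fun v => gaussian v * gaussMass v)
      (-v * (gaussian v * gaussMass v) - gaussian v * gaussian v) v := by
  have h : HasDerivAt (fun v => gaussian v * gaussMass v)
      (-v * gaussian v * gaussMass v + gaussian v * -gaussian v) v :=
    (hasDerivAt_gaussian v).mul (hasDerivAt_gaussMass v)
  exact h.congr_deriv (by ring)

/-- With `g` the kernel and `G` the mass, `G' = -g` and `g' = -v g`. Integrating the derivative of
`v^(n+1) g G` over the half-line gives the recursion, and that of `g G` gives the case `n = 1`. -/
theorem integral_pow_mul_gaussian_mul_gaussMass (n : ℕ) :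
    ∫ v in Iic (0 : ℝ), v ^ n * (gaussian v * gaussMass v) = gaussMassMoment n := by
  have hint := integrableOn_pow_mul_gaussian_mul_gaussMass
  have hsq := integrableOn_pow_mul_gaussian_sq
  -- Integrability of both `f` and `f'` forces `f` to vanish at `-∞`.
  have hftc : ∀ {f f' : ℝ → ℝ}, (∀ v, HasDerivAt f (f' v) v) → IntegrableOn f (Iic 0) →
      IntegrableOn f' (Iic 0) → ∫ v in Iic (0 : ℝ), f' v = f 0 := by
    intro f f' hf hfi hfi'
    rw [integral_Iic_of_hasDerivAt_of_tendsto' (fun v _ => hf v) hfi'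
      (tendsto_zero_of_hasDerivAt_of_integrableOn_Iic (fun v _ => hf v) hfi' hfi), sub_zero]
  induction n using Nat.twoStepInduction with
  | zero =>
    -- This antiderivative tends to `-1/8` rather than `0`, so `hftc` is not available here.
    have hd : ∀ v, HasDerivAt (fun v => -(gaussMass v ^ 2) / 2)
        (v ^ 0 * (gaussian v * gaussMass v)) v := by
      intro v
      have h : HasDerivAt (fun v => -(gaussMass v ^ 2) / 2)
          (-((2 : ℕ) * gaussMass v ^ (2 - 1) * -gaussian v) / 2) v :=
        (((hasDerivAt_gaussMass v).pow 2).neg).div_const 2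
      refine h.congr_deriv ?_
      push_cast
      ring
    rw [integral_Iic_of_hasDerivAt_of_tendsto' (fun v _ => hd v) (hint 0)
      ((tendsto_gaussMass.pow 2).neg.div_const 2), gaussMass_zero, gaussMassMoment]
    norm_num
  | one =>
    have h0 : IntegrableOn (fun v => gaussian v * gaussMass v) (Iic 0) := by
      simpa using hint 0
    have h1 : IntegrableOn (fun v => v * (gaussian v * gaussMass v)) (Iic 0) := by
      simpa using hint 1
    have h2 : IntegrableOn (fun v => gaussian v * gaussian v) (Iic 0) := by
      simpa using hsq 0
    have h3 : IntegrableOn (fun v => -v * (gaussian v * gaussMass v)) (Iic 0) := by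
      simp only [neg_mul]
      exact h1.neg
    have h := hftc hasDerivAt_gaussian_mul_gaussMass h0 (h3.sub h2)
    rw [integral_sub h3 h2, gaussMass_zero, mul_zero] at h
    simp only [neg_mul, integral_neg] at h
    have hs := integral_pow_mul_gaussian_sq 0
    simp only [pow_zero, one_mul] at hs
    rw [hs, gaussSqMoment] at h
    simp only [pow_one, gaussMassMoment]
    linarith
  | more n ih _ =>
    have hd : ∀ v, HasDerivAt (fun v => v ^ (n + 1) * (gaussian v * gaussMass v))
        ((n + 1) * (v ^ n * (gaussian v * gaussMass v)) -
          v ^ (n + 2) * (gaussian v * gaussMass v) -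
          v ^ (n + 1) * (gaussian v * gaussian v)) v := by
      intro v
      have h : HasDerivAt (fun v => v ^ (n + 1) * (gaussian v * gaussMass v))
          (((n + 1 : ℕ) : ℝ) * v ^ (n + 1 - 1) * (gaussian v * gaussMass v) +
            v ^ (n + 1) * (-v * (gaussian v * gaussMass v) - gaussian v * gaussian v)) v :=
        (hasDerivAt_pow (n + 1) v).mul (hasDerivAt_gaussian_mul_gaussMass v)
      refine h.congr_deriv ?_
      rw [Nat.add_sub_cancel]
      push_cast
      ring
    have h1 : IntegrableOn (fun v => ((n : ℝ) + 1) * (v ^ n * (gaussian v * gaussMass v)))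
        (Iic 0) := (hint n).const_mul _
    have h2 : IntegrableOn (fun v => ((n : ℝ) + 1) * (v ^ n * (gaussian v * gaussMass v)) -
        v ^ (n + 2) * (gaussian v * gaussMass v)) (Iic 0) := h1.sub (hint (n + 2))
    have h := hftc hd (hint (n + 1)) (h2.sub (hsq (n + 1)))
    rw [integral_sub h2 (hsq (n + 1)), integral_sub h1 (hint (n + 2)), integral_const_mul,
      gaussMass_zero, ih, integral_pow_mul_gaussian_sq] at h
    rw [gaussMassMoment]
    simp only [mul_zero] at h
    linarith

end GaussianTail

/-! ### Entries of `B` for the Gaussian kernel. -/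

section GaussianMatrix

/-- The entries of `B_{p,K}` for the Gaussian kernel and `p ≤ 3`. -/
noncomputable def gaussMin (i j : ℕ) : ℝ :=
  match i with
  | 0 => gaussMassMoment (j + 1) - gaussSqMoment j
  | 1 => gaussMoment j / 2 - gaussPeak * gaussMoment (j + 1) - gaussMassMoment j
  | 2 => gaussMassMoment (j + 1) - 2 * gaussSqMoment j
  | _ => 3 / 2 * gaussMoment j - 2 * gaussPeak * gaussMoment (j + 1) - gaussSqMoment (j + 1) -
      3 * gaussMassMoment j

/-- For `i ≤ 3` a second antiderivative of `u^i g` lies in the span of `g`, `u g`, `G` and `u G`,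
where `G` is `gaussMass`; `α, β, γ, δ` are its coordinates. The formula prescribed for `H₁` is the
derivative of that combination. -/
theorem matB_gaussian_of_antideriv {p : ℕ} {i j : Fin (p + 1)} {H₁ : ℝ → ℝ} (α β γ δ : ℝ)
    (hH₁ : ∀ u, H₁ u = (β + γ * -1) * gaussian u + -(α + δ) * (u * gaussian u) +
      -β * (u ^ 2 * gaussian u) + δ * gaussMass u)
    (hH₁' : ∀ u, HasDerivAt H₁ (u ^ (i : ℕ) * gaussian u) u) :
    matB p gaussian i j =
      (gaussMoment (i + 1) + α * gaussPeak) * gaussMoment j +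
        (β - γ) * gaussPeak * gaussMoment (j + 1) -
      (α * gaussSqMoment j + β * gaussSqMoment (j + 1) + γ * gaussMassMoment j +
        δ * gaussMassMoment (j + 1)) := by
  have hH : ∀ u, HasDerivAt (fun u => α * gaussian u + β * (u * gaussian u) + γ * gaussMass u +
      δ * (u * gaussMass u)) (H₁ u) u := by
    intro u
    have h : HasDerivAt (fun u => α * gaussian u + β * (u * gaussian u) + γ * gaussMass u +
        δ * (u * gaussMass u)) (α * (-u * gaussian u) +
          β * (1 * gaussian u + u * (-u * gaussian u)) + γ * -gaussian u +
          δ * (1 * gaussMass u + u * -gaussian u)) u :=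
      ((((hasDerivAt_gaussian u).const_mul α).add
        (((hasDerivAt_id u).mul (hasDerivAt_gaussian u)).const_mul β)).add
        ((hasDerivAt_gaussMass u).const_mul γ)).add
        (((hasDerivAt_id u).mul (hasDerivAt_gaussMass u)).const_mul δ)
    refine h.congr_deriv ?_
    rw [hH₁]
    ring
  have hH₁c : Continuous H₁ := continuous_iff_continuousAt.2 fun u => (hH₁' u).continuousAt
  have hrepr : ∀ v, v ^ (j : ℕ) * gaussian v * (α * gaussian v + β * (v * gaussian v) +
      γ * gaussMass v + δ * (v * gaussMass v)) =
      (α * (v ^ (j : ℕ) * (gaussian v * gaussian v)) +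
        β * (v ^ ((j : ℕ) + 1) * (gaussian v * gaussian v))) +
      (γ * (v ^ (j : ℕ) * (gaussian v * gaussMass v)) +
        δ * (v ^ ((j : ℕ) + 1) * (gaussian v * gaussMass v))) := by
    intro v
    ring
  have hs := fun (d : ℝ) (n : ℕ) => (integrableOn_pow_mul_gaussian_sq n).const_mul d
  have hm := fun (d : ℝ) (n : ℕ) => (integrableOn_pow_mul_gaussian_mul_gaussMass n).const_mul d
  have h1 : IntegrableOn (fun v => α * (v ^ (j : ℕ) * (gaussian v * gaussian v)) +
      β * (v ^ ((j : ℕ) + 1) * (gaussian v * gaussian v))) (Iic 0) := (hs _ _).add (hs _ _)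
  have h2 : IntegrableOn (fun v => γ * (v ^ (j : ℕ) * (gaussian v * gaussMass v)) +
      δ * (v ^ ((j : ℕ) + 1) * (gaussian v * gaussMass v))) (Iic 0) := (hm _ _).add (hm _ _)
  have h12 : IntegrableOn (fun v => v ^ (j : ℕ) * gaussian v * (α * gaussian v +
      β * (v * gaussian v) + γ * gaussMass v + δ * (v * gaussMass v))) (Iic 0) := by
    simp only [hrepr]
    exact h1.add h2
  rw [matB_apply integrableOn_pow_mul_gaussian hH hH₁c (fun _ _ _ u _ => hH₁' u) h12]
  simp only [hrepr]
  rw [integral_add h1 h2, integral_add (hs _ _) (hs _ _), integral_add (hm _ _) (hm _ _)]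
  simp only [integral_const_mul, integral_pow_mul_gaussian_sq,
    integral_pow_mul_gaussian_mul_gaussMass, moment_gaussian, hH₁, gaussian_zero, gaussMass_zero]
  ring

theorem matB_gaussian {p : ℕ} (hp : p ≤ 3) (i j : Fin (p + 1)) :
    matB p gaussian i j = gaussMin i j := by
  have hi : (i : ℕ) ≤ 3 := by omega
  have hmul : ∀ u, HasDerivAt (fun u => u * gaussian u) ((1 - u ^ 2) * gaussian u) u := by
    intro u
    have h : HasDerivAt (fun u => u * gaussian u) (1 * gaussian u + u * (-u * gaussian u)) u :=
      (hasDerivAt_id u).mul (hasDerivAt_gaussian u)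
    exact h.congr_deriv (by ring)
  have hsq : ∀ u, HasDerivAt (fun u => u ^ 2 * gaussian u)
      ((2 * u - u ^ 3) * gaussian u) u := by
    intro u
    have h : HasDerivAt (fun u => u ^ 2 * gaussian u)
        ((2 : ℕ) * u ^ (2 - 1) * gaussian u + u ^ 2 * (-u * gaussian u)) u :=
      (hasDerivAt_pow 2 u).mul (hasDerivAt_gaussian u)
    refine h.congr_deriv ?_
    push_cast
    ring
  obtain h | h | h | h : (i : ℕ) = 0 ∨ (i : ℕ) = 1 ∨ (i : ℕ) = 2 ∨ (i : ℕ) = 3 := by omega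
  -- The second antiderivatives for `i = 0, 1, 2, 3` are `g - u G`, `G`, `2 g - u G` and `u g + 3
  -- G`.
  · rw [matB_gaussian_of_antideriv (H₁ := fun u => -gaussMass u) 1 0 0 (-1) (fun u => by ring)
      (fun u => (hasDerivAt_gaussMass u).neg.congr_deriv (by rw [h]; ring)), h]
    simp only [gaussMin, gaussMoment]
    ring
  · rw [matB_gaussian_of_antideriv (H₁ := fun u => -gaussian u) 0 0 1 0 (fun u => by ring)
      (fun u => (hasDerivAt_gaussian u).neg.congr_deriv (by rw [h]; ring)), h]
    simp only [gaussMin, gaussMoment]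
    push_cast
    ring
  · rw [matB_gaussian_of_antideriv (H₁ := fun u => -(u * gaussian u) - gaussMass u) 2 0 0 (-1)
      (fun u => by ring)
      (fun u => ((hmul u).neg.sub (hasDerivAt_gaussMass u)).congr_deriv (by rw [h]; ring)), h]
    simp only [gaussMin, gaussMoment]
    push_cast
    ring
  · rw [matB_gaussian_of_antideriv (H₁ := fun u => -(u ^ 2 * gaussian u) - 2 * gaussian u) 0 1 3 0
      (fun u => by ring)
      (fun u => ((hsq u).neg.sub ((hasDerivAt_gaussian u).const_mul 2)).congr_deriv
        (by rw [h]; ring)), h]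
    simp only [gaussMin, gaussMoment]
    push_cast
    ring

end GaussianMatrix

/-! ### Numerical enclosures of `1/√(2π)`, `1/(4√π)` and their monomials. -/

section GaussianBounds

theorem gaussPeak_pos : 0 < gaussPeak := by
  unfold gaussPeak
  positivity

theorem gaussSqMass_pos : 0 < gaussSqMass := by
  unfold gaussSqMass
  positivity

theorem gaussSqMass_sq : gaussSqMass ^ 2 = 1 / (16 * Real.pi) := by
  rw [gaussSqMass, div_pow, mul_pow, Real.sq_sqrt Real.pi_pos.le]
  norm_num

/-- High precision allows for cancellation: at `p = 3` the squared determinant is about `2 · 10⁻⁶`,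
while individual terms of the variance numerator are of order one. -/
theorem gaussPeak_mem : gaussPeak ∈ Icc (0.39894228040143 : ℝ) 0.39894228040144 := by
  have h1 := Real.pi_gt_d20
  have h2 := Real.pi_lt_d20
  have h := gaussPeak_sq
  constructor
  · refine (sq_le_sq₀ (by norm_num) gaussPeak_pos.le).1 ?_
    rw [h, le_div_iff₀ (by positivity)]
    linarith
  · refine (sq_le_sq₀ gaussPeak_pos.le (by norm_num)).1 ?_
    rw [h, div_le_iff₀ (by positivity)]
    linarith

theorem gaussSqMass_mem : gaussSqMass ∈ Icc (0.14104739588693 : ℝ) 0.14104739588694 := by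
  have h1 := Real.pi_gt_d20
  have h2 := Real.pi_lt_d20
  have h := gaussSqMass_sq
  constructor
  · refine (sq_le_sq₀ (by norm_num) gaussSqMass_pos.le).1 ?_
    rw [h, le_div_iff₀ (by positivity)]
    linarith
  · refine (sq_le_sq₀ gaussSqMass_pos.le (by norm_num)).1 ?_
    rw [h, div_le_iff₀ (by positivity)]
    linarith

theorem gaussPeak_pow_mem (n : ℕ) :
    gaussPeak ^ n ∈ Icc ((0.39894228040143 : ℝ) ^ n) (0.39894228040144 ^ n) :=
  ⟨pow_le_pow_left₀ (by norm_num) gaussPeak_mem.1 n,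
    pow_le_pow_left₀ gaussPeak_pos.le gaussPeak_mem.2 n⟩

/-- Each monomial gets its own enclosure, so the final polynomial inequalities are linear in the
monomials. -/
theorem gaussSqMass_mul_gaussPeak_pow_mem (n : ℕ) :
    gaussSqMass * gaussPeak ^ n ∈ Icc ((0.14104739588693 : ℝ) * 0.39894228040143 ^ n)
      (0.14104739588694 * 0.39894228040144 ^ n) :=
  ⟨mul_le_mul gaussSqMass_mem.1 (gaussPeak_pow_mem n).1 (by positivity) gaussSqMass_pos.le,
    mul_le_mul gaussSqMass_mem.2 (gaussPeak_pow_mem n).2 (pow_nonneg gaussPeak_pos.le n)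
      (by norm_num)⟩

end GaussianBounds

/-! ### Lower bounds for the Gaussian constants. -/

section GaussianConstants

theorem gaussian_constants_one : (2.19 : ℝ) ^ 2 ≤ biasConst 1 gaussian ^ 2 ∧
    0.48 ≤ varConst 1 gaussian := by
  obtain ⟨s, hs⟩ : ∃ s, s = gaussPeak := ⟨_, rfl⟩
  obtain ⟨r, hr⟩ : ∃ r, r = gaussSqMass := ⟨_, rfl⟩
  -- Here `d` is the determinant of `A`, so by Cramer's rule the solution of `A a = e₁` is a vector
  -- of cofactors over `d`. The same holds for `p = 2, 3`.
  obtain ⟨d, hd⟩ : ∃ d, d = 1 / 4 - s ^ 2 := ⟨_, rfl⟩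
  have s1 := gaussPeak_mem
  have s2 := gaussPeak_pow_mem 2
  have s3 := gaussPeak_pow_mem 3
  have s4 := gaussPeak_pow_mem 4
  have r0 := gaussSqMass_mem
  have r2 := gaussSqMass_mul_gaussPeak_pow_mem 2
  simp only [← hs, ← hr, mem_Icc] at s1 s2 s3 s4 r0 r2
  norm_num at s2 s3 s4 r2
  have hd0 : 0 < d := by rw [hd]; linarith
  have h := constants_one (s / d) (1 / 2 / d) moment_gaussian (matB_gaussian (by norm_num))
    (by norm_num [gaussMoment, ← hs]; intro h0; rw [hd] at hd0; linarith)
    (by norm_num [gaussMoment, ← hs]; field_simp; ring)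
    (by norm_num [gaussMoment, ← hs]; field_simp; rw [hd]; ring)
  have hB : biasConst 1 gaussian = -(1 / 2 * s) / d := by
    rw [h.1]
    norm_num [gaussMoment, ← hs]
    field_simp
    ring
  have hV : varConst 1 gaussian = (r / 4 - s / 8 - 2 * (r * s ^ 2) + s ^ 3) / d ^ 2 := by
    rw [h.2]
    norm_num [gaussMin, gaussMoment, gaussMassMoment, gaussSqMoment, ← hs, ← hr]
    field_simp
    ring
  rw [hB, hV]
  constructor
  · rw [neg_div, neg_sq]
    refine pow_le_pow_left₀ (by norm_num) ?_ 2
    rw [le_div_iff₀ hd0, hd]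
    linarith
  · rw [le_div_iff₀ (by positivity), hd]
    linarith

theorem gaussian_constants_two : (4.06 : ℝ) ^ 2 ≤ biasConst 2 gaussian ^ 2 ∧
    1.74 ≤ varConst 2 gaussian := by
  obtain ⟨s, hs⟩ : ∃ s, s = gaussPeak := ⟨_, rfl⟩
  obtain ⟨r, hr⟩ : ∃ r, r = gaussSqMass := ⟨_, rfl⟩
  obtain ⟨d, hd⟩ : ∃ d, d = 1 / 4 - 3 / 2 * s ^ 2 := ⟨_, rfl⟩
  have s1 := gaussPeak_mem
  have s2 := gaussPeak_pow_mem 2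
  have s3 := gaussPeak_pow_mem 3
  have s4 := gaussPeak_pow_mem 4
  have r0 := gaussSqMass_mem
  have r2 := gaussSqMass_mul_gaussPeak_pow_mem 2
  simp only [← hs, ← hr, mem_Icc] at s1 s2 s3 s4 r0 r2
  norm_num at s2 s3 s4 r2
  have hd0 : 0 < d := by rw [hd]; linarith
  have h := constants_two (s / 2 / d) (1 / 2 / d) (s / 2 / d) moment_gaussian
    (matB_gaussian (by norm_num))
    (by norm_num [gaussMoment, ← hs]; intro h0; rw [hd] at hd0; linarith)
    (by norm_num [gaussMoment, ← hs]; field_simp; ring)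
    (by norm_num [gaussMoment, ← hs]; field_simp; rw [hd]; ring)
    (by norm_num [gaussMoment, ← hs]; field_simp; ring)
  have hB : biasConst 2 gaussian = -(5 * s ^ 2 - 3 / 4) / d := by
    rw [h.1]
    norm_num [gaussMoment, ← hs]
    field_simp
    ring
  have hV : varConst 2 gaussian =
      (r / 4 - s / 8 - 23 / 8 * (r * s ^ 2) + 5 / 4 * s ^ 3) / d ^ 2 := by
    rw [h.2]
    norm_num [gaussMin, gaussMoment, gaussMassMoment, gaussSqMoment, ← hs, ← hr]
    field_simp
    ring
  rw [hB, hV]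
  constructor
  · rw [neg_div, neg_sq]
    refine pow_le_pow_left₀ (by norm_num) ?_ 2
    rw [le_div_iff₀ hd0, hd]
    linarith
  · rw [le_div_iff₀ (by positivity), hd]
    linarith

theorem gaussian_constants_three : (7.36 : ℝ) ^ 2 ≤ biasConst 3 gaussian ^ 2 ∧
    3.8 ≤ varConst 3 gaussian := by
  obtain ⟨s, hs⟩ : ∃ s, s = gaussPeak := ⟨_, rfl⟩
  obtain ⟨r, hr⟩ : ∃ r, r = gaussSqMass := ⟨_, rfl⟩
  obtain ⟨d, hd⟩ : ∃ d, d = 3 / 4 - 29 / 4 * s ^ 2 + 16 * s ^ 4 := ⟨_, rfl⟩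
  have s1 := gaussPeak_mem
  have s2 := gaussPeak_pow_mem 2
  have s3 := gaussPeak_pow_mem 3
  have s4 := gaussPeak_pow_mem 4
  have s5 := gaussPeak_pow_mem 5
  have s6 := gaussPeak_pow_mem 6
  have s7 := gaussPeak_pow_mem 7
  have s8 := gaussPeak_pow_mem 8
  have r0 := gaussSqMass_mem
  have r2 := gaussSqMass_mul_gaussPeak_pow_mem 2
  have r4 := gaussSqMass_mul_gaussPeak_pow_mem 4
  have r6 := gaussSqMass_mul_gaussPeak_pow_mem 6
  simp only [← hs, ← hr, mem_Icc] at s1 s2 s3 s4 s5 s6 s7 s8 r0 r2 r4 r6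
  norm_num at s2 s3 s4 s5 s6 s7 s8 r2 r4 r6
  have hd0 : 0 < d := by rw [hd]; linarith
  have h := constants_three ((21 / 4 * s - 32 * s ^ 3) / d) ((15 / 4 - 22 * s ^ 2) / d)
    ((8 * s ^ 3 - 3 / 4 * s) / d) ((5 * s ^ 2 - 3 / 4) / d) moment_gaussian
    (matB_gaussian (by norm_num))
    (by
      rw [det_hankel_four]
      norm_num [gaussMoment, ← hs]
      intro h0
      rw [hd] at hd0
      linarith)
    (by norm_num [gaussMoment, ← hs]; field_simp; ring)
    (by norm_num [gaussMoment, ← hs]; field_simp; rw [hd]; ring)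
    (by norm_num [gaussMoment, ← hs]; field_simp; ring)
    (by norm_num [gaussMoment, ← hs]; field_simp; ring)
  have hB : biasConst 3 gaussian = -(52 * s ^ 3 - 33 / 4 * s) / d := by
    rw [h.1]
    norm_num [gaussMoment, ← hs]
    field_simp
    ring
  have hV : varConst 3 gaussian =
      (243 / 64 * r - 27 / 16 * s - 2331 / 32 * (r * s ^ 2) + 63 / 2 * s ^ 3 +
        1683 / 4 * (r * s ^ 4) - 723 / 4 * s ^ 5 - 736 * (r * s ^ 6) + 320 * s ^ 7) / d ^ 2 := by
    rw [h.2]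
    norm_num [gaussMin, gaussMoment, gaussMassMoment, gaussSqMoment, ← hs, ← hr]
    field_simp
    ring
  rw [hB, hV]
  constructor
  · rw [neg_div, neg_sq]
    refine pow_le_pow_left₀ (by norm_num) ?_ 2
    rw [le_div_iff₀ hd0, hd]
    linarith
  · rw [le_div_iff₀ (by positivity), hd]
    linarith

end GaussianConstants

end LPD

theorem proposition1 (p : ℕ) (hp : p ∈ ({1, 2, 3} : Set ℕ)) (K : ℝ → ℝ)
    (hK : K ∈ LPD.kernelClass) (hne : K ≠ LPD.spline) :
    LPD.varConst p LPD.spline < LPD.varConst p K ∧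
    LPD.mseConst p LPD.spline < LPD.mseConst p K ∧
    (∀ (f₀ h : ℝ) (n : ℕ), 0 < f₀ → 0 < h → 1 ≤ n →
      LPD.asymVar p LPD.spline f₀ n h < LPD.asymVar p K f₀ n h) ∧
    (∀ (f₀ fp : ℝ) (n : ℕ), 0 < f₀ → fp ≠ 0 → 1 ≤ n →
      LPD.asymMSE p LPD.spline f₀ fp n (LPD.mseBandwidth p LPD.spline f₀ fp n) <
        LPD.asymMSE p K f₀ fp n (LPD.mseBandwidth p K f₀ fp n)) := by
  open LPD in
  -- Exact values are needed for the spline-type kernel only. A competitor needs lower bounds `β`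
  -- and `v₀`, and exact values serve as such in the compactly supported cases.
  have key : ∀ {p : ℕ} {v b v₀ β : ℝ}, 1 ≤ p → biasConst p spline = b ∧ varConst p spline = v →
      0 < v → b ≠ 0 → β ≤ biasConst p K ^ 2 → v₀ ≤ varConst p K → v < v₀ →
      b ^ 2 * v ^ (2 * p) < β * v₀ ^ (2 * p) →
      varConst p spline < varConst p K ∧ mseConst p spline < mseConst p K ∧
      (∀ (f₀ h : ℝ) (n : ℕ), 0 < f₀ → 0 < h → 1 ≤ n →
        asymVar p spline f₀ n h < asymVar p K f₀ n h) ∧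
      (∀ (f₀ fp : ℝ) (n : ℕ), 0 < f₀ → fp ≠ 0 → 1 ≤ n →
        asymMSE p spline f₀ fp n (mseBandwidth p spline f₀ fp n) <
          asymMSE p K f₀ fp n (mseBandwidth p K f₀ fp n)) := by
    intro p v b v₀ β hp hspline hv hb hβ hV hlt hmse
    refine minimality_of_constants hp (by rwa [hspline.2]) (by rw [hspline.2]; linarith)
      (by rwa [hspline.1]) ?_
    rw [hspline.1, hspline.2]
    exact hmse.trans_le (mul_le_mul hβ (pow_le_pow_left₀ (by linarith) hV _)
      (pow_nonneg (by linarith) _) (sq_nonneg _))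
  simp only [LPD.kernelClass, Set.mem_insert_iff, Set.mem_singleton_iff] at hK hp
  rcases hK with rfl | rfl | rfl | rfl | rfl
  · rcases hp with rfl | rfl | rfl
    · exact key (by norm_num) LPD.spline_constants_one (by norm_num) (by norm_num)
        (congrArg (· ^ 2) LPD.triangular_constants_one.1).ge LPD.triangular_constants_one.2.ge
        (by norm_num) (by norm_num)
    · exact key (by norm_num) LPD.spline_constants_two (by norm_num) (by norm_num)
        (congrArg (· ^ 2) LPD.triangular_constants_two.1).ge LPD.triangular_constants_two.2.ge
        (by norm_num) (by norm_num)
    · exact key (by norm_num) LPD.spline_constants_three (by norm_num) (by norm_num)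
        (congrArg (· ^ 2) LPD.triangular_constants_three.1).ge LPD.triangular_constants_three.2.ge
        (by norm_num) (by norm_num)
  · rcases hp with rfl | rfl | rfl
    · exact key (by norm_num) LPD.spline_constants_one (by norm_num) (by norm_num)
        (congrArg (· ^ 2) LPD.uniform_constants_one.1).ge LPD.uniform_constants_one.2.ge
        (by norm_num) (by norm_num)
    · exact key (by norm_num) LPD.spline_constants_two (by norm_num) (by norm_num)
        (congrArg (· ^ 2) LPD.uniform_constants_two.1).ge LPD.uniform_constants_two.2.ge
        (by norm_num) (by norm_num)
    · exact key (by norm_num) LPD.spline_constants_three (by norm_num) (by norm_num)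
        (congrArg (· ^ 2) LPD.uniform_constants_three.1).ge LPD.uniform_constants_three.2.ge
        (by norm_num) (by norm_num)
  · rcases hp with rfl | rfl | rfl
    · exact key (by norm_num) LPD.spline_constants_one (by norm_num) (by norm_num)
        (congrArg (· ^ 2) LPD.epanechnikov_constants_one.1).ge LPD.epanechnikov_constants_one.2.ge
        (by norm_num) (by norm_num)
    · exact key (by norm_num) LPD.spline_constants_two (by norm_num) (by norm_num)
        (congrArg (· ^ 2) LPD.epanechnikov_constants_two.1).ge LPD.epanechnikov_constants_two.2.ge
        (by norm_num) (by norm_num)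
    · exact key (by norm_num) LPD.spline_constants_three (by norm_num) (by norm_num)
        (congrArg (· ^ 2) LPD.epanechnikov_constants_three.1).ge LPD.epanechnikov_constants_three.2.ge
        (by norm_num) (by norm_num)
  · rcases hp with rfl | rfl | rfl
    · exact key (by norm_num) LPD.spline_constants_one (by norm_num) (by norm_num)
        LPD.gaussian_constants_one.1 LPD.gaussian_constants_one.2
        (by norm_num) (by norm_num)
    · exact key (by norm_num) LPD.spline_constants_two (by norm_num) (by norm_num)
        LPD.gaussian_constants_two.1 LPD.gaussian_constants_two.2
        (by norm_num) (by norm_num)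
    · exact key (by norm_num) LPD.spline_constants_three (by norm_num) (by norm_num)
        LPD.gaussian_constants_three.1 LPD.gaussian_constants_three.2
        (by norm_num) (by norm_num)
  · exact absurd rfl hne
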